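/- **Setting.** A randomised algorithm $M$ maps datasets $d\in\mathcal X^n$, for every $n\in\mathbb N$, to random outputs (through a Markov kernel for each $n$). It is $\varepsilon$-differentially private ($\varepsilon$-DP) if $\Pr[M(d)\in E]\le e^{\varepsilon}\Pr[M(d')\in E]$ for every $n$, all datasets $d,d'\in\mathcal X^n$ that differ in a single record, and all measurable $E$. Let $\mathcal F$ be the class of all randomised estimators (real-valued randomised algorithms) and $\mathcal F_\varepsilon\subseteq\mathcal F$ the class of all $\varepsilon$-DP ones. For a class $\mathcal G$ of estimators, $\mathcal G^{\rm test}$ is the class of tests $T_{f,\tau}(X)=\mathbf 1\{f(X)\ge\tau\}$ with $f\in\mathcal G$, $\tau\in\mathbb R$. For distributions $P,Q$ let $${\rm SC}_T(P,Q)=\inf\{n : \Pr[T(P^N)=0]\ge 0.75 \text{ and } \Pr[T(Q^N)=1]\ge 0.75\ \text{ for all } N\ge n\},$$ and ${\rm SC}_{\mathcal G^{\rm test}}(P,Q)=\inf_{T\in\mathcal G^{\rm test}}{\rm SC}_T(P,Q)$. Let $\mu$ be a measure on $\mathbb R$ that is not concentrated at a single point (in particular $\mu\ne0$), let $A(\theta)=\ln\int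 e^{\theta x}\,d\mu(x)$, $\Phi=\{\theta : A(\theta)<\infty\}$, let $P_\theta$ be the distribution with density $e^{\theta x-A(\theta)}$ with respect to $\mu$, and let $\mathcal P_\mu=\{P_\theta:\theta\in\Phi\}$. For a class $\mathcal G$ of estimators define the modulus of continuity $$\omega_n(P_\theta,\mathcal G^{\rm test})=\sup\{|\theta-\theta'| : \theta'\in\Phi,\ {\rm SC}_{\mathcal G^{\rm test}}(P_\theta,P_{\theta'})>n\}$$ and the optimal local estimation rate $$\mathcal E_n^{\rm loc}(P_\theta,\mathcal G)=\sup_{\theta'\in\Phi}\ \inf_{\hat\theta\in\mathcal G}\ \max\{E_n(\hat\theta,P_\theta),E_n(\hat\theta,P_{\theta'})\},$$ where $E_n(\hat\theta,P_\theta)$ is the least $r$ such that $|\hat\theta(X_1,\dots,X_n)-\theta|\le r$ with probability at least $0.75$ when $X_1,\dots,X_n\sim P_\theta$ are i.i.d. For $\theta$ in the interior of $\Phi$ let $\kappa(\theta)\in[0,\infty]$ be the supremum of all $r$ such that $[\theta-r,\theta+r]$ lies in the interior of $\Phi$ and $A''(\theta)/A''(\theta')\in[\frac12,2]$ for all $\theta'\in[\theta-r,\theta+r]$,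 and let $\Phi(\theta)$ be the set of the points of $[\theta-\kappa(\theta),\theta+\kappa(\theta)]$ in the interior of $\Phi$. **Statement.** For every $\zeta>0$ there are positive constants $k,C_1,C_2,C_3,C_4$ and $N$, depending only on $\zeta$, such that for all such measures $\mu$, all sequences $(\varepsilon_n)$, all $\theta$ in the interior of $\Phi$ and all $n\ge N$: if * $\varepsilon_n\ge k/\sqrt n$, * $\dfrac{\mathbb E_{\theta'}\big[(x-A'(\theta'))^4\big]}{A''(\theta')^2}\le\zeta$ for all $\theta'\in\Phi(\theta)$, and * $\kappa(\theta)\ge \dfrac{C_2}{\sqrt{nA''(\theta)}}$, then $$\frac{C_1}{\sqrt{nA''(\theta)}}\le\omega_n(P_\theta,\mathcal F_{\varepsilon_n}^{\rm test})\le\frac{C_2}{\sqrt{nA''(\theta)}},\qquad C_3\,\omega_n(P_\theta,\mathcal F^{\rm test})\le\omega_n(P_\theta,\mathcal F_{\varepsilon_n}^{\rm test})\le C_4\,\omega_n(P_\theta,\mathcal F^{\rm test}),$$ and $$\frac{C_1}{2\sqrt{nA''(\theta)}}\le\mathcal E_n^{\rm loc}(P_\theta,\mathcal F_{\varepsilon_n})\le\frac{C_2}{2\sqrt{nA''(\theta)}},\qquad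 C_3\,\mathcal E_n^{\rm loc}(P_\theta,\mathcal F)\le\mathcal E_n^{\rm loc}(P_\theta,\mathcal F_{\varepsilon_n})\le C_4\,\mathcal E_n^{\rm loc}(P_\theta,\mathcal F).$$ So in this low-privacy regime the optimal $\varepsilon_n$-DP local estimation rate equals the non-private one up to constants that depend only on $\zeta$. -/

import Mathlib

open MeasureTheory ProbabilityTheory
open scoped ENNReal

namespace PrivEst

section General

variable {χ Y : Type*} [MeasurableSpace χ] [MeasurableSpace Y]

/-- A randomised algorithm that takes datasets over `χ` of every finite size and outputs an
element of `Y`: one Markov kernel for each sample size. -/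
structure Mechanism (χ Y : Type*) [MeasurableSpace χ] [MeasurableSpace Y] where
  kernel : ∀ n : ℕ, Kernel (Fin n → χ) Y
  markov : ∀ n : ℕ, IsMarkovKernel (kernel n)

/-- The law of `M(X₁, …, Xₙ)` for `X₁, …, Xₙ` i.i.d. from `P`, over the randomness of both the
sample and the algorithm. -/
noncomputable def Mechanism.outputLaw (M : Mechanism χ Y) (n : ℕ) (P : Measure χ) : Measure Y :=
  (Measure.pi fun _ : Fin n => P).bind (M.kernel n)

/-- Two datasets of the same size are neighbouring if one arises from the other by changing a
single record. -/
def Neighbouring {n : ℕ} (d d' : Fin n → χ) : Prop :=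
  ∃ i : Fin n, ∀ j : Fin n, j ≠ i → d j = d' j

/-- `(ε, δ)`-differential privacy (at every sample size). -/
def Mechanism.IsDP (M : Mechanism χ Y) (ε δ : ℝ) : Prop :=
  ∀ (n : ℕ) (d d' : Fin n → χ), Neighbouring d d' → ∀ E : Set Y, MeasurableSet E →
    M.kernel n d E ≤ ENNReal.ofReal (Real.exp ε) * M.kernel n d' E + ENNReal.ofReal δ

/-- Real-valued randomised estimators. -/
abbrev Estimator (χ : Type*) [MeasurableSpace χ] := Mechanism χ ℝ

/-- Randomised binary tests; `false` is the answer `0` and `true` is the answer `1`. -/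
abbrev BinaryTest (χ : Type*) [MeasurableSpace χ] := Mechanism χ Bool

/-- The class of all estimators. -/
def allEstimators (χ : Type*) [MeasurableSpace χ] : Set (Estimator χ) := Set.univ

/-- The class of all `ε`-differentially private estimators. -/
def dpEstimators (χ : Type*) [MeasurableSpace χ] (ε : ℝ) : Set (Estimator χ) :=
  {M | M.IsDP ε 0}

theorem measurable_decide_le (τ : ℝ) : Measurable fun y : ℝ => decide (τ ≤ y) := by
  refine measurable_to_bool ?_
  have h : (fun y : ℝ => decide (τ ≤ y)) ⁻¹' {true} = Set.Ici τ := by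
    ext y
    simp
  rw [h]
  exact measurableSet_Ici

/-- The test that thresholds the estimator `f` at `τ`: it answers `0` if `f(X) < τ` and `1`
otherwise. -/
noncomputable def thresholdTest (f : Estimator χ) (τ : ℝ) : BinaryTest χ where
  kernel n := (f.kernel n).map fun y => decide (τ ≤ y)
  markov n :=
    haveI := f.markov n
    Kernel.IsMarkovKernel.map (f.kernel n) (measurable_decide_le τ)

/-- The class of tests obtained by thresholding the estimators of a class. -/
def testClass (F : Set (Estimator χ)) : Set (BinaryTest χ) :=
  {T | ∃ f ∈ F, ∃ τ : ℝ, T = thresholdTest f τ}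

/-- `T` distinguishes `P` from `Q` with `N` samples. -/
def Distinguishes (T : BinaryTest χ) (P Q : Measure χ) (N : ℕ) : Prop :=
  3 / 4 ≤ T.outputLaw N P {false} ∧ 3 / 4 ≤ T.outputLaw N Q {true}

/-- The sample complexity of a test: the least `n` such that the test distinguishes `P` from `Q`
with `N` samples for all `N ≥ n` (`⊤` if there is none). -/
noncomputable def sampleComplexity (T : BinaryTest χ) (P Q : Measure χ) : ℕ∞ :=
  ⨅ (n : ℕ) (_ : ∀ N : ℕ, n ≤ N → Distinguishes T P Q N), (n : ℕ∞)

/-- The sample complexity of a class of tests. -/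
noncomputable def classSampleComplexity (G : Set (BinaryTest χ)) (P Q : Measure χ) : ℕ∞ :=
  ⨅ T ∈ G, sampleComplexity T P Q

/-- The modulus of continuity at `P`, for the class of tests `G`, the family of distributions
`Fam` and the functional `t` on it. -/
noncomputable def modulus (n : ℕ) (P : Measure χ) (G : Set (BinaryTest χ))
    (Fam : Set (Measure χ)) (t : Measure χ → ℝ) : ℝ≥0∞ :=
  ⨆ (Q : Measure χ) (_ : Q ∈ Fam) (_ : (n : ℕ∞) < classSampleComplexity G P Q),
    ENNReal.ofReal |t P - t Q|

/-- The error of the estimator `f` at `P` with `n` samples: the least `r` such that, with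
probability at least `0.75`, the estimate is within `r` of `t P`. -/
noncomputable def errorRate (f : Estimator χ) (n : ℕ) (P : Measure χ) (t : Measure χ → ℝ) :
    ℝ≥0∞ :=
  sInf {r : ℝ≥0∞ | 3 / 4 ≤ f.outputLaw n P {y | ENNReal.ofReal |y - t P| ≤ r}}

/-- The optimal local estimation rate at `P`, for the class of estimators `F`, the family of
distributions `Fam` and the functional `t` on it. -/
noncomputable def localRate (n : ℕ) (P : Measure χ) (Fam : Set (Measure χ))
    (F : Set (Estimator χ)) (t : Measure χ → ℝ) : ℝ≥0∞ :=
  ⨆ Q ∈ Fam, ⨅ f ∈ F, max (errorRate f n P t) (errorRate f n Q t)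

end General

section ExponentialFamily

/-- The natural parameter space `Φ`: all `θ` with `∫ exp (θ x) dμ(x) < ∞`. -/
def paramSpace (μ : Measure ℝ) : Set ℝ := integrableExpSet id μ

/-- The log-partition function `A(θ) = log ∫ exp (θ x) dμ(x)`. -/
noncomputable def logPartition (μ : Measure ℝ) : ℝ → ℝ := cgf id μ

/-- The derivative `A'`. -/
noncomputable def logPartition' (μ : Measure ℝ) : ℝ → ℝ := deriv (logPartition μ)

/-- The second derivative `A''`. -/
noncomputable def logPartition'' (μ : Measure ℝ) : ℝ → ℝ := iteratedDeriv 2 (logPartition μ)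

/-- The member `P_θ` of the exponential family with base measure `μ`: its density with respect
to `μ` is `exp (θ x) / ∫ exp (θ y) dμ(y) = exp (θ x - A(θ))`. -/
noncomputable def expDist (μ : Measure ℝ) (θ : ℝ) : Measure ℝ := μ.tilted fun x => θ * x

/-- The one-parameter exponential family with base measure `μ`. -/
def expFamily (μ : Measure ℝ) : Set (Measure ℝ) := expDist μ '' paramSpace μ

/-- The functional `P_θ ↦ θ` on the exponential family. -/
noncomputable def expParam (μ : Measure ℝ) : Measure ℝ → ℝ :=
  Function.invFunOn (expDist μ) (paramSpace μ)

/-- If `μ` is not concentrated at a single point then `P_θ` determines `θ`. -/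
theorem injOn_expDist (μ : Measure ℝ) (hμ : ∀ a : ℝ, μ {a}ᶜ ≠ 0) :
    Set.InjOn (expDist μ) (paramSpace μ) := by
  intro s hs t ht hst
  by_contra hne
  have : NeZero μ := ⟨fun h => hμ 0 (by simp [h])⟩
  have hs' : Integrable (fun x => Real.exp (s * x)) μ := hs
  have ht' : Integrable (fun x => Real.exp (t * x)) μ := ht
  have : IsFiniteMeasure (expDist μ s) := by unfold expDist; infer_instance
  unfold expDist Measure.tilted at hst
  rw [withDensity_eq_iff (by fun_prop) (by fun_prop)] at hst
  · set a := ∫ x, Real.exp (s * x) ∂μ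
    set b := ∫ x, Real.exp (t * x) ∂μ
    have ha : 0 < a := integral_exp_pos hs'
    have hb : 0 < b := integral_exp_pos ht'
    apply hμ ((Real.log a - Real.log b) / (s - t))
    have hh : ∀ᵐ x ∂μ, x = (Real.log a - Real.log b) / (s - t) := by
      filter_upwards [hst] with x hx
      rw [ENNReal.ofReal_eq_ofReal_iff (by positivity) (by positivity)] at hx
      have := congrArg Real.log hx
      rw [Real.log_div (by positivity) ha.ne', Real.log_div (by positivity) hb.ne', Real.log_exp,
        Real.log_exp] at this
      have h3 : s - t ≠ 0 := sub_ne_zero.2 hne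
      field_simp
      linarith
    exact hh
  · have := measure_ne_top (expDist μ s) Set.univ
    unfold expDist Measure.tilted at this
    simpa using this

/-- The functional is the intended one: it maps `P_θ` to `θ`. -/
theorem expParam_expDist (μ : Measure ℝ) (hμ : ∀ a : ℝ, μ {a}ᶜ ≠ 0) (θ : ℝ)
    (h : θ ∈ paramSpace μ) : expParam μ (expDist μ θ) = θ :=
  (injOn_expDist μ hμ).leftInvOn_invFunOn h

/-- The radius of smoothness `κ(θ)` of `A''` around `θ`: the largest `r ∈ [0, ∞]` such that
`A''` is defined on all of `[θ - r, θ + r]` and `A''(θ) / A''(θ') ∈ [1/2, 2]` for all `θ'` in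
this interval. -/
noncomputable def kappa (μ : Measure ℝ) (θ : ℝ) : ℝ≥0∞ :=
  sSup {r : ℝ≥0∞ | ∀ θ' : ℝ, ENNReal.ofReal |θ' - θ| ≤ r →
    θ' ∈ interior (paramSpace μ) ∧
      logPartition'' μ θ / logPartition'' μ θ' ∈ Set.Icc (1 / 2 : ℝ) 2}

/-- The interval `Φ(θ) = [θ - κ(θ), θ + κ(θ)]`. (If the supremum `κ(θ)` is not attained, then
an end point may be a boundary point of the parameter space; such a point is left out.) -/
def smoothInterval (μ : Measure ℝ) (θ : ℝ) : Set ℝ :=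
  {θ' | θ' ∈ interior (paramSpace μ) ∧ ENNReal.ofReal |θ' - θ| ≤ kappa μ θ}

/-- The central standardised fourth moment of `P_θ`. -/
noncomputable def kurtosis (μ : Measure ℝ) (θ : ℝ) : ℝ :=
  (∫ x, (x - logPartition' μ θ) ^ 4 ∂(expDist μ θ)) / (logPartition'' μ θ) ^ 2

end ExponentialFamily

end PrivEst

open PrivEst

/-! Both rates are squeezed between a non-private lower bound and a private upper bound of the same
order `1 / √(n A''(θ))`. Enlarging the class of estimators can only decrease the modulus and the
local rate, so these two bounds give all the inequalities.

Lower bound: the chi-square divergence of `P_{θ+s}^n` from `P_θ^n`, plus one, is the exponential of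
`n` times a second difference of `A`. While `A'' ≤ 2 A''(θ)` this exponent is at most `2 n A''(θ)
s²`, so at `s = 1 / (4 √(n A''(θ)))` no randomised algorithm separates the two laws
(`not_separated_expDist`).

Upper bound: suppose some `[0, 1]`-valued `h` has means under `P_θ` and `P_θ'` that differ by `12 /
√n`. Changing one record moves `∑ h(xᵢ)` by at most `1`, so a logistic choice with score `ε ∑ (h(xᵢ)
- c)` is `ε`-DP. For `c` midway between the means and `ε ≥ 1 / √n`, the score is at least `3` in
size with the right sign outside a small Chebyshev event, so privacy costs only a constant.

Such an `h` is a ramp around `A'(θ)` whose width is a multiple of the standard deviation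
(`exists_separating_function`). The derivative of `u ↦ E_u h` is the covariance of `h` with `x`. It
would be proportional to `A''(u)` if `h` were linear, and the fourth moment bound controls the loss
from clipping. This gives the gap at distance of order `1 / √(n A''(θ))`. Since `h` is monotone, so
is `u ↦ E_u h`, and the gap persists for every more distant `θ'`, even where nothing is known about
`A''`. -/

namespace PrivEst

/-! ### Densities of product measures -/

section Product

variable {χ : Type*} [MeasurableSpace χ] {P : Measure χ} [IsProbabilityMeasure P]

theorem lintegral_pi_prod {n : ℕ} {g : Fin n → χ → ℝ≥0∞} (hg : ∀ i, Measurable (g i)) :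
    ∫⁻ x, ∏ i, g i (x i) ∂(Measure.pi fun _ : Fin n => P) = ∏ i, ∫⁻ x, g i x ∂P := by
  have h := lintegral_prod_eq_prod_lintegral_of_indepFun (μ := Measure.pi fun _ : Fin n => P)
    Finset.univ (fun i x => g i (x i)) (iIndepFun_pi fun i => (hg i).aemeasurable)
    (fun i => (hg i).comp (measurable_pi_apply i))
  rw [h]
  refine Finset.prod_congr rfl fun i _ => ?_
  exact (measurePreserving_eval (fun _ : Fin n => P) i).lintegral_comp (hg i)

theorem pi_withDensity_const (n : ℕ) {f : χ → ℝ≥0∞} (hf : Measurable f)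
    [IsProbabilityMeasure (P.withDensity f)] :
    (Measure.pi fun _ : Fin n => P.withDensity f) =
      (Measure.pi fun _ : Fin n => P).withDensity fun x => ∏ i, f (x i) := by
  refine (Measure.pi_eq fun s hs => ?_)
  rw [withDensity_apply _ (MeasurableSet.univ_pi hs),
    ← lintegral_indicator (MeasurableSet.univ_pi hs)]
  have h : ∀ x : Fin n → χ, (Set.univ.pi s).indicator (fun x => ∏ i, f (x i)) x
      = ∏ i, (s i).indicator f (x i) := by
    intro x
    by_cases hx : x ∈ Set.univ.pi s
    · rw [Set.indicator_of_mem hx]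
      exact Finset.prod_congr rfl fun i _ => (Set.indicator_of_mem (hx i trivial) f).symm
    · rw [Set.indicator_of_notMem hx]
      simp only [Set.mem_pi, Set.mem_univ, forall_const, not_forall] at hx
      obtain ⟨i, hi⟩ := hx
      exact (Finset.prod_eq_zero (Finset.mem_univ i) (Set.indicator_of_notMem hi f)).symm
  simp_rw [h]
  rw [lintegral_pi_prod fun i => hf.indicator (hs i)]
  refine Finset.prod_congr rfl fun i _ => ?_
  rw [withDensity_apply _ (hs i), lintegral_indicator (hs i)]

end Product

/-! ### Indistinguishability from a chi-square bound -/

section Mechanism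

variable {χ Y : Type*} [MeasurableSpace χ] [MeasurableSpace Y]

theorem Mechanism.outputLaw_apply (M : Mechanism χ Y) (n : ℕ) (P : Measure χ) {E : Set Y}
    (hE : MeasurableSet E) :
    M.outputLaw n P E = ∫⁻ d, M.kernel n d E ∂(Measure.pi fun _ : Fin n => P) :=
  Measure.bind_apply hE (M.kernel n).measurable.aemeasurable

theorem Mechanism.outputLaw_univ (M : Mechanism χ Y) (n : ℕ) (P : Measure χ)
    [IsProbabilityMeasure P] : M.outputLaw n P Set.univ = 1 := by
  have := M.markov n
  rw [M.outputLaw_apply n P MeasurableSet.univ]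
  simp

/-- Expand `(a - 1 - b / 2)² ≥ 0` and use `b² / 4 ≤ 1 / 4`. Here `a` plays the likelihood ratio and
`b` the probability that the algorithm answers in `E`. -/
theorem chi_square_pointwise {a b : ℝ≥0∞} (hb : b ≤ 1) :
    a * b + 2 * a ≤ b + 5 / 4 + a ^ 2 := by
  by_cases ha : a = ∞
  · simp [ha]
  lift a to NNReal using ha
  lift b to NNReal using (ne_top_of_le_ne_top ENNReal.one_ne_top hb)
  have h54 : (5 / 4 : ℝ≥0∞) = ((5 / 4 : NNReal) : ℝ≥0∞) := by
    rw [ENNReal.coe_div (by norm_num)]; norm_num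
  rw [h54]
  norm_cast
  rw [← NNReal.coe_le_coe]
  push_cast
  nlinarith [sq_nonneg ((a : ℝ) - 1 - b / 2), sq_nonneg (b : ℝ), b.2,
    (by exact_mod_cast hb : (b : ℝ) ≤ 1)]

/-- Two product measures whose chi-square divergence is less than `1 / 4` cannot be told apart
with probability `3 / 4`. -/
theorem not_separated_of_lintegral_sq_lt {P : Measure χ} [IsProbabilityMeasure P]
    {f : χ → ℝ≥0∞} (hf : Measurable f) [IsProbabilityMeasure (P.withDensity f)] {n : ℕ}
    (hχ : (∫⁻ x, f x ^ 2 ∂P) ^ n < 5 / 4) (M : Mechanism χ Y) {E : Set Y}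
    (hE : MeasurableSet E) :
    ¬ (3 / 4 ≤ M.outputLaw n P Eᶜ ∧ 3 / 4 ≤ M.outputLaw n (P.withDensity f) E) := by
  rintro ⟨h1, h2⟩
  have := M.markov n
  set Pn := Measure.pi fun _ : Fin n => P
  set Λ : (Fin n → χ) → ℝ≥0∞ := fun x => ∏ i, f (x i)
  have hΛ : Measurable Λ :=
    Finset.measurable_prod _ fun i _ => hf.comp (measurable_pi_apply i)
  have hφ : Measurable fun d => M.kernel n d E := (M.kernel n).measurable_coe hE
  have hQ : M.outputLaw n (P.withDensity f) E = ∫⁻ d, Λ d * M.kernel n d E ∂Pn := by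
    rw [M.outputLaw_apply _ _ hE, pi_withDensity_const n hf,
      lintegral_withDensity_eq_lintegral_mul _ hΛ hφ]
    rfl
  have hΛ1 : ∫⁻ d, Λ d ∂Pn = 1 := by
    rw [lintegral_pi_prod fun _ => hf]
    have : ∫⁻ x, f x ∂P = 1 := by
      rw [← setLIntegral_univ, ← withDensity_apply _ MeasurableSet.univ, measure_univ]
    simp [this]
  have hΛ2 : ∫⁻ d, Λ d ^ 2 ∂Pn = (∫⁻ x, f x ^ 2 ∂P) ^ n := by
    have := lintegral_pi_prod (P := P) (n := n) (g := fun _ x => f x ^ 2)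
      fun _ => hf.pow_const 2
    simpa [Λ, Finset.prod_pow] using this
  -- Integrated, the pointwise bound reads `Q(E) + 2 ≤ P(E) + 5/4 + ∫ Λ²`. With `∫ Λ² < 5/4` this
  -- forces `Q(E) - P(E) < 1/2`, whereas separation would make the difference at least `1/2`.
  -- Stating it with sums avoids subtraction in `ℝ≥0∞`.
  have key : ∫⁻ d, (Λ d * M.kernel n d E + 2 * Λ d) ∂Pn
      ≤ ∫⁻ d, (M.kernel n d E + 5 / 4 + Λ d ^ 2) ∂Pn :=
    lintegral_mono fun d => chi_square_pointwise prob_le_one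
  have hΛφ : Measurable fun d => Λ d * M.kernel n d E := hΛ.mul hφ
  rw [lintegral_add_left hΛφ, lintegral_const_mul _ hΛ, hΛ1, ← hQ,
    lintegral_add_left (hφ.add_const _), lintegral_add_left hφ, lintegral_const,
    ← M.outputLaw_apply _ _ hE, hΛ2] at key
  have hsum : M.outputLaw n P E + M.outputLaw n P Eᶜ = 1 := by
    rw [measure_add_measure_compl hE, M.outputLaw_univ]
  simp only [measure_univ, mul_one] at key
  have hfin : M.outputLaw n P E ≠ ∞ := fun h => by simp [h] at hsum
  have hfin' : M.outputLaw n P Eᶜ ≠ ∞ := fun h => by simp [h] at hsum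
  have hfq : M.outputLaw n (P.withDensity f) E ≠ ∞ :=
    ne_top_of_le_ne_top ENNReal.one_ne_top
      ((measure_mono (Set.subset_univ _)).trans (M.outputLaw_univ n _).le)
  have hfx : (∫⁻ x, f x ^ 2 ∂P) ^ n ≠ ∞ := ne_top_of_lt hχ
  have e1 := (ENNReal.toReal_le_toReal (by simp [hfq]) (by finiteness)).2 key
  have e2 := congrArg ENNReal.toReal hsum
  have e3 := (ENNReal.toReal_le_toReal (by finiteness) hfin').2 h1
  have e4 := (ENNReal.toReal_le_toReal (by finiteness) hfq).2 h2
  have e5 := (ENNReal.toReal_lt_toReal hfx (by finiteness)).2 hχ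
  rw [ENNReal.toReal_add hfin hfin'] at e2
  rw [ENNReal.toReal_add hfq (by finiteness), ENNReal.toReal_add (by finiteness) hfx,
    ENNReal.toReal_add hfin (by finiteness)] at e1
  simp at e1 e2 e3 e4 e5
  linarith

end Mechanism

/-! ### The private logistic test: privacy and accuracy -/

section Logistic

variable {χ : Type*} [MeasurableSpace χ]

/-- The estimator that outputs `b` with logistic probability in the score
`ε * ∑ i, (h (x i) - c)` and `a` otherwise. -/
noncomputable def logisticEstimator (h : χ → ℝ) (hh : Measurable h) (c ε a b : ℝ) :
    Estimator χ where
  kernel n :=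
    { toFun := fun d =>
        ENNReal.ofReal (Real.sigmoid (-(ε * ∑ i, (h (d i) - c)))) • Measure.dirac a +
          ENNReal.ofReal (Real.sigmoid (ε * ∑ i, (h (d i) - c))) • Measure.dirac b
      measurable' := by
        refine Measure.measurable_of_measurable_coe _ fun s hs => ?_
        simp only [Measure.add_apply, Measure.smul_apply, smul_eq_mul]
        have : Measurable Real.sigmoid := Real.sigmoid_monotone.measurable
        fun_prop }
  markov n := ⟨fun d => ⟨by
    simp only [Kernel.coe_mk, Measure.add_apply, Measure.smul_apply, smul_eq_mul, measure_univ,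
      mul_one]
    rw [← ENNReal.ofReal_add (Real.sigmoid_nonneg _) (Real.sigmoid_nonneg _), Real.sigmoid_neg]
    simp⟩⟩

theorem logisticEstimator_kernel_apply {h : χ → ℝ} (hh : Measurable h) (c ε a b : ℝ) (n : ℕ)
    (d : Fin n → χ) (E : Set ℝ) :
    (logisticEstimator h hh c ε a b).kernel n d E =
      ENNReal.ofReal (Real.sigmoid (-(ε * ∑ i, (h (d i) - c)))) * Measure.dirac a E +
        ENNReal.ofReal (Real.sigmoid (ε * ∑ i, (h (d i) - c))) * Measure.dirac b E := by
  simp [logisticEstimator]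

/-- The logarithm of the sigmoid is increasing and 1-Lipschitz. This is the source of privacy. -/
theorem sigmoid_le_exp_mul_sigmoid {x y ε : ℝ} (hε : 0 ≤ ε) (hxy : x - y ≤ ε) :
    Real.sigmoid x ≤ Real.exp ε * Real.sigmoid y := by
  rw [Real.sigmoid_def, Real.sigmoid_def, ← div_eq_mul_inv, ← one_div,
    div_le_div_iff₀ (by positivity) (by positivity)]
  have h1 : Real.exp (-y) ≤ Real.exp ε * Real.exp (-x) := by
    rw [← Real.exp_add]
    exact Real.exp_le_exp.2 (by linarith)
  have h2 := Real.one_le_exp hε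
  linarith

theorem abs_sum_sub_sum_le_one {χ : Type*} {h : χ → ℝ} (h01 : ∀ x, h x ∈ Set.Icc (0 : ℝ) 1) (c : ℝ)
    {n : ℕ} {d d' : Fin n → χ} (hd : Neighbouring d d') :
    |∑ i, (h (d i) - c) - ∑ i, (h (d' i) - c)| ≤ 1 := by
  obtain ⟨i, hi⟩ := hd
  rw [← Finset.sum_sub_distrib, Finset.sum_eq_single i]
  · have := h01 (d i)
    have := h01 (d' i)
    simp only [Set.mem_Icc] at *
    rw [abs_le]
    constructor <;> linarith
  · intro j _ hj
    rw [hi j hj]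
    ring
  · simp

/-- The score has sensitivity `ε`, so the weights of `a` and of `b` each change by a factor of at
most `exp ε`. -/
theorem logisticEstimator_isDP {h : χ → ℝ} (hh : Measurable h)
    (h01 : ∀ x, h x ∈ Set.Icc (0 : ℝ) 1) (c : ℝ) {ε : ℝ} (hε : 0 ≤ ε) (a b : ℝ) :
    (logisticEstimator h hh c ε a b).IsDP ε 0 := by
  intro n d d' hd E _
  rw [logisticEstimator_kernel_apply, logisticEstimator_kernel_apply, ENNReal.ofReal_zero,
    add_zero, mul_add, ← mul_assoc, ← mul_assoc, ← ENNReal.ofReal_mul (by positivity),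
    ← ENNReal.ofReal_mul (by positivity)]
  have := abs_le.1 (abs_sum_sub_sum_le_one h01 c hd)
  gcongr
  · exact sigmoid_le_exp_mul_sigmoid hε (by nlinarith)
  · exact sigmoid_le_exp_mul_sigmoid hε (by nlinarith)

/-- With equal outputs the logistic choice is deterministic, which makes this a constant estimator.
-/
theorem isDP_const (y : ℝ) {ε : ℝ} (hε : 0 ≤ ε) :
    (logisticEstimator (fun _ : χ => (0 : ℝ)) measurable_const 0 ε y y).IsDP ε 0 :=
  logisticEstimator_isDP _ (fun _ => by simp) 0 hε y y

/-- The sum concentrates at scale `√n`, while its mean lies `n δ / 2`, a large multiple of `√n`,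
below `n c`. Chebyshev gives a good event of probability at least `7/8`, on which the sigmoid is at
least `7/8`. -/
theorem three_quarters_le_lintegral_sigmoid {P : Measure χ} [IsProbabilityMeasure P]
    {h : χ → ℝ} (hh : Measurable h) (h01 : ∀ x, h x ∈ Set.Icc (0 : ℝ) 1) {c δ ε : ℝ} {n : ℕ}
    (hc : ∫ x, h x ∂P ≤ c - δ / 2) (hδ : 12 ≤ √n * δ) (hε : 1 ≤ √n * ε) :
    3 / 4 ≤ ∫⁻ d, ENNReal.ofReal (Real.sigmoid (-(ε * ∑ i, (h (d i) - c))))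
      ∂(Measure.pi fun _ : Fin n => P) := by
  have hsn : 0 ≤ √(n : ℝ) := Real.sqrt_nonneg _
  have hnn : √(n : ℝ) * √(n : ℝ) = n := Real.mul_self_sqrt (Nat.cast_nonneg n)
  have hn0 : 0 < √(n : ℝ) := by
    rcases hsn.lt_or_eq with h | h
    · exact h
    · rw [← h] at hδ; norm_num at hδ
  have hδ0 : 0 < δ := by by_contra hcon; nlinarith
  have hε0 : 0 < ε := by by_contra hcon; nlinarith
  have hnpos : 0 < (n : ℝ) := by nlinarith
  set Pn := Measure.pi fun _ : Fin n => P
  set T : (Fin n → χ) → ℝ := ∑ i, fun d => h (d i)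
  have hmem : MemLp h 2 P := by
    refine MemLp.of_bound hh.aestronglyMeasurable 1 (ae_of_all _ fun x => ?_)
    rw [Real.norm_eq_abs, abs_of_nonneg (h01 x).1]
    exact (h01 x).2
  have hTm : MemLp T 2 Pn := memLp_finsetSum' _ fun i _ =>
    hmem.comp_measurePreserving (measurePreserving_eval (fun _ : Fin n => P) i)
  have hTE : ∫ d, T d ∂Pn = n * ∫ x, h x ∂P := by
    simp only [T, Finset.sum_apply]
    rw [integral_finsetSum]
    · have : ∀ i : Fin n, ∫ d : Fin n → χ, h (d i) ∂Pn = ∫ x, h x ∂P := fun i =>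
        integral_comp_eval (μ := fun _ : Fin n => P) hh.aestronglyMeasurable
      simp [this]
    · intro i _
      exact integrable_comp_eval (μ := fun _ : Fin n => P) (hmem.integrable (by norm_num))
  have hTV : Var[T; Pn] ≤ n / 4 := by
    rw [variance_sum_pi (X := fun _ : Fin n => h) fun _ => hmem]
    have : Var[h; P] ≤ ((1 - 0) / 2) ^ 2 :=
      variance_le_sq_of_bounded (ae_of_all _ h01) hh.aemeasurable
    simp only [Finset.sum_const, Finset.card_univ, Fintype.card_fin, nsmul_eq_mul]
    nlinarith
  -- Half of the distance from the mean of the sum to `n c`: Chebyshev bounds the bad event by `4 /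
  -- (n δ²) ≤ 1/36`, and the other half keeps the score below `-ε r ≤ -3`.
  set r : ℝ := n * δ / 4
  have hr : 0 < r := by positivity
  have hnd : 144 ≤ n * δ ^ 2 := by
    have : n * δ ^ 2 = (√n * δ) ^ 2 := by rw [mul_pow, pow_two (√(n : ℝ)), hnn]
    rw [this]; nlinarith
  have hcheb : Pn {d | r ≤ |T d - ∫ d, T d ∂Pn|} ≤ ENNReal.ofReal (1 / 8) := by
    refine (meas_ge_le_variance_div_sq hTm hr).trans (ENNReal.ofReal_le_ofReal ?_)
    rw [div_le_iff₀ (by positivity)]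
    refine hTV.trans ?_
    simp only [r]
    nlinarith
  have hTmeas : Measurable T := by
    have : T = fun d => ∑ i, h (d i) := by ext; simp [T]
    rw [this]
    exact Finset.measurable_sum _ fun i _ => hh.comp (measurable_pi_apply i)
  set B := {d | r ≤ |T d - ∫ d, T d ∂Pn|}
  have hB : MeasurableSet B := measurableSet_le measurable_const (by fun_prop)
  have hBc : ENNReal.ofReal (7 / 8) ≤ Pn Bᶜ := by
    rw [prob_compl_eq_one_sub hB]
    refine le_trans ?_ (tsub_le_tsub_left hcheb 1)
    rw [← ENNReal.ofReal_one, ← ENNReal.ofReal_sub _ (by norm_num)]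
    norm_num
  have hpt : ∀ d ∈ Bᶜ, ENNReal.ofReal (7 / 8)
      ≤ ENNReal.ofReal (Real.sigmoid (-(ε * ∑ i, (h (d i) - c)))) := by
    intro d hd
    simp only [B, Set.mem_compl_iff, Set.mem_ofPred_eq, not_le, hTE] at hd
    have h1 := (abs_lt.1 hd).2
    have hS : ∑ i, (h (d i) - c) = T d - n * c := by simp [T]
    have hS' : ∑ i, (h (d i) - c) ≤ -r := by
      rw [hS]
      simp only [r] at *
      nlinarith
    have h3 : 3 ≤ ε * r := by
      have : ε * r = (√n * ε) * (√n * δ) / 4 := by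
        simp only [r]; linear_combination (-(ε * δ / 4)) * hnn
      rw [this]; nlinarith
    refine ENNReal.ofReal_le_ofReal ?_
    refine le_trans ?_ (Real.sigmoid_le (show (3 : ℝ) ≤ _ by nlinarith))
    rw [Real.sigmoid_def, ← one_div, div_le_div_iff₀ (by norm_num) (by positivity), Real.exp_neg]
    have h7 : 7 ≤ Real.exp 3 := by
      have : Real.exp 3 = Real.exp 1 ^ 3 := by rw [← Real.exp_nat_mul]; norm_num
      rw [this]
      calc (7 : ℝ) ≤ 2 ^ 3 := by norm_num
        _ ≤ Real.exp 1 ^ 3 := by gcongr; linarith [Real.exp_one_gt_d9]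
    have : (Real.exp 3)⁻¹ ≤ 7⁻¹ := inv_anti₀ (by norm_num) h7
    linarith
  calc (3 / 4 : ℝ≥0∞) = ENNReal.ofReal (3 / 4) := by
        rw [ENNReal.ofReal_div_of_pos (by norm_num)]; simp
    _ ≤ ENNReal.ofReal (7 / 8) * ENNReal.ofReal (7 / 8) := by
        rw [← ENNReal.ofReal_mul (by norm_num)]
        exact ENNReal.ofReal_le_ofReal (by norm_num)
    _ ≤ ENNReal.ofReal (7 / 8) * Pn Bᶜ := by gcongr
    _ = ∫⁻ _ in Bᶜ, ENNReal.ofReal (7 / 8) ∂Pn := by simp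
    _ ≤ ∫⁻ d in Bᶜ, ENNReal.ofReal (Real.sigmoid (-(ε * ∑ i, (h (d i) - c)))) ∂Pn :=
        setLIntegral_mono' hB.compl hpt
    _ ≤ _ := setLIntegral_le_lintegral _ _

theorem logisticEstimator_outputLaw_left {P : Measure χ} [IsProbabilityMeasure P]
    {h : χ → ℝ} (hh : Measurable h) (h01 : ∀ x, h x ∈ Set.Icc (0 : ℝ) 1) {c δ ε : ℝ} {n : ℕ}
    (hc : ∫ x, h x ∂P ≤ c - δ / 2) (hδ : 12 ≤ √n * δ) (hε : 1 ≤ √n * ε) {a b : ℝ}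
    {E : Set ℝ} (hE : MeasurableSet E) (ha : a ∈ E) :
    3 / 4 ≤ (logisticEstimator h hh c ε a b).outputLaw n P E := by
  rw [Mechanism.outputLaw_apply _ _ _ hE]
  refine (three_quarters_le_lintegral_sigmoid hh h01 hc hδ hε).trans (lintegral_mono fun d => ?_)
  rw [logisticEstimator_kernel_apply, Measure.dirac_apply_of_mem ha, mul_one]
  exact le_self_add

theorem logisticEstimator_outputLaw_right {P : Measure χ} [IsProbabilityMeasure P]
    {h : χ → ℝ} (hh : Measurable h) (h01 : ∀ x, h x ∈ Set.Icc (0 : ℝ) 1) {c δ ε : ℝ} {n : ℕ}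
    (hc : c + δ / 2 ≤ ∫ x, h x ∂P) (hδ : 12 ≤ √n * δ) (hε : 1 ≤ √n * ε) {a b : ℝ}
    {E : Set ℝ} (hE : MeasurableSet E) (hb : b ∈ E) :
    3 / 4 ≤ (logisticEstimator h hh c ε a b).outputLaw n P E := by
  rw [Mechanism.outputLaw_apply _ _ _ hE]
  have hint : Integrable h P := by
    refine Integrable.of_bound hh.aestronglyMeasurable 1 (ae_of_all _ fun x => ?_)
    rw [Real.norm_eq_abs, abs_of_nonneg (h01 x).1]
    exact (h01 x).2
  have hc' : ∫ x, (1 - h x) ∂P ≤ (1 - c) - δ / 2 := by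
    rw [integral_sub (integrable_const _) hint]
    simp
    linarith
  -- Replacing `h` by `1 - h` and `c` by `1 - c` flips the sign of the score, so the other half of
  -- the accuracy claim follows by symmetry.
  refine (three_quarters_le_lintegral_sigmoid (hh.const_sub 1)
    (fun x => by have := h01 x; simp only [Set.mem_Icc] at *; constructor <;> linarith)
    hc' hδ hε).trans (lintegral_mono fun d => ?_)
  rw [logisticEstimator_kernel_apply, Measure.dirac_apply_of_mem hb, mul_one]
  have : -(ε * ∑ i, (1 - h (d i) - (1 - c))) = ε * ∑ i, (h (d i) - c) := by
    rw [← mul_neg, ← Finset.sum_neg_distrib]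
    congr 1
    exact Finset.sum_congr rfl fun i _ => by ring
  rw [this]
  exact le_add_self

end Logistic

/-! ### Moments and likelihood ratios in the exponential family -/

section ExponentialFamily

variable {μ : Measure ℝ} {θ θ' u : ℝ}

theorem neZero_of_forall_compl_ne_zero (hμ : ∀ a : ℝ, μ {a}ᶜ ≠ 0) : NeZero μ :=
  ⟨fun h => hμ 0 (by simp [h])⟩

theorem integrable_exp_of_mem_paramSpace (h : θ ∈ paramSpace μ) :
    Integrable (fun x => Real.exp (θ * x)) μ := h

theorem isProbabilityMeasure_expDist [NeZero μ] (h : θ ∈ paramSpace μ) :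
    IsProbabilityMeasure (expDist μ θ) :=
  isProbabilityMeasure_tilted (integrable_exp_of_mem_paramSpace h)

theorem exp_logPartition [NeZero μ] (h : θ ∈ paramSpace μ) :
    Real.exp (logPartition μ θ) = ∫ x, Real.exp (θ * x) ∂μ :=
  exp_cgf (X := id) (integrable_exp_of_mem_paramSpace h)

theorem integral_exp_expDist [NeZero μ] (h : θ ∈ paramSpace μ) {t : ℝ}
    (h' : θ + t ∈ paramSpace μ) :
    ∫ x, Real.exp (t * x) ∂(expDist μ θ) =
      Real.exp (logPartition μ (θ + t) - logPartition μ θ) := by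
  rw [expDist, integral_exp_tilted, Real.exp_sub, exp_logPartition h, exp_logPartition h']
  simp [add_mul]

theorem integrable_exp_expDist (h : θ ∈ paramSpace μ) {t : ℝ} (h' : θ + t ∈ paramSpace μ) :
    Integrable (fun x => Real.exp (t * x)) (expDist μ θ) := by
  rw [expDist, integrable_tilted_iff (integrable_exp_of_mem_paramSpace h)]
  simp only [smul_eq_mul, ← Real.exp_add, ← add_mul]
  exact h'

theorem tilted_expDist (h : θ ∈ paramSpace μ) (t : ℝ) :
    (expDist μ θ).tilted (fun x => t * x) = expDist μ (θ + t) := by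
  rw [expDist, tilted_tilted (integrable_exp_of_mem_paramSpace h), expDist]
  congr 1
  ext x
  simp [add_mul]

/-- The likelihood ratio of `P_{θ + t}` with respect to `P_θ`. -/
noncomputable def likelihoodRatio (μ : Measure ℝ) (θ t x : ℝ) : ℝ≥0∞ :=
  ENNReal.ofReal (Real.exp (t * x - (logPartition μ (θ + t) - logPartition μ θ)))

theorem measurable_likelihoodRatio (μ : Measure ℝ) (θ t : ℝ) :
    Measurable (likelihoodRatio μ θ t) := by
  unfold likelihoodRatio
  fun_prop

theorem expDist_withDensity [NeZero μ] (h : θ ∈ paramSpace μ) {t : ℝ}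
    (h' : θ + t ∈ paramSpace μ) :
    (expDist μ θ).withDensity (likelihoodRatio μ θ t) = expDist μ (θ + t) := by
  rw [← tilted_expDist h, Measure.tilted, integral_exp_expDist h h']
  congr 1
  ext x
  rw [likelihoodRatio, Real.exp_sub]

/-- Squaring `exp (t x - K)` gives `exp (2 t x - 2 K)`, whose mean is again a ratio of partition
functions. -/
theorem lintegral_likelihoodRatio_sq [NeZero μ] (h : θ ∈ paramSpace μ) {t : ℝ}
    (h' : θ + 2 * t ∈ paramSpace μ) :
    ∫⁻ x, likelihoodRatio μ θ t x ^ 2 ∂(expDist μ θ) =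
      ENNReal.ofReal (Real.exp
        (logPartition μ (θ + 2 * t) - 2 * logPartition μ (θ + t) + logPartition μ θ)) := by
  set K := logPartition μ (θ + t) - logPartition μ θ
  have hsq : ∀ x, likelihoodRatio μ θ t x ^ 2 =
      ENNReal.ofReal (Real.exp (-2 * K) * Real.exp (2 * t * x)) := by
    intro x
    rw [likelihoodRatio, ← ENNReal.ofReal_pow (Real.exp_nonneg _), ← Real.exp_nat_mul,
      ← Real.exp_add]
    congr 2
    push_cast
    ring
  simp_rw [hsq]
  rw [← ofReal_integral_eq_lintegral_ofReal ((integrable_exp_expDist h h').const_mul _)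
    (ae_of_all _ fun x => by positivity), integral_const_mul, integral_exp_expDist h h',
    ← Real.exp_add]
  congr 2
  simp only [K]
  ring

theorem integral_id_expDist (h : θ ∈ interior (paramSpace μ)) :
    ∫ x, x ∂(expDist μ θ) = logPartition' μ θ :=
  integral_tilted_mul_self (X := id) h

theorem memLp_id_expDist (h : θ ∈ interior (paramSpace μ)) (p : NNReal) :
    MemLp (fun x => x) p (expDist μ θ) :=
  memLp_tilted_mul (X := id) h p

theorem integrable_sub_pow_expDist [NeZero μ] (h : θ ∈ interior (paramSpace μ)) (m : ℝ) (k : ℕ) :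
    Integrable (fun x => (x - m) ^ k) (expDist μ θ) := by
  have := isProbabilityMeasure_expDist (interior_subset h)
  have h1 : MemLp (fun x => x - m) k (expDist μ θ) :=
    (memLp_id_expDist h (k : NNReal)).sub (memLp_const m)
  have h2 := h1.integrable_norm_pow'
  rw [← integrable_norm_iff (by fun_prop)]
  simpa [norm_pow] using h2

theorem integral_sub_sq_expDist (h : θ ∈ interior (paramSpace μ)) :
    ∫ x, (x - logPartition' μ θ) ^ 2 ∂(expDist μ θ) = logPartition'' μ θ := by
  have h1 := variance_tilted_mul (X := id) h
  rw [variance_eq_integral aemeasurable_id, integral_tilted_mul_self (X := id) h] at h1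
  exact h1

/-- `A''(θ)` is the variance of `P_θ`. If it vanished, `P_θ` would sit at its mean, and so would
`μ`, which is absolutely continuous with respect to `P_θ`. -/
theorem logPartition''_pos (hμ : ∀ a : ℝ, μ {a}ᶜ ≠ 0) (h : θ ∈ interior (paramSpace μ)) :
    0 < logPartition'' μ θ := by
  have := neZero_of_forall_compl_ne_zero hμ
  have hnn : 0 ≤ logPartition'' μ θ := by
    rw [← integral_sub_sq_expDist h]
    exact integral_nonneg fun x => sq_nonneg _
  refine hnn.lt_of_ne fun h0 => ?_
  rw [← integral_sub_sq_expDist h] at h0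
  have h1 := (integral_eq_zero_iff_of_nonneg (fun x => sq_nonneg _)
    (integrable_sub_pow_expDist h _ 2)).1 h0.symm
  apply hμ (logPartition' μ θ)
  have h2 : ∀ᵐ x ∂(expDist μ θ), x = logPartition' μ θ := by
    filter_upwards [h1] with x hx
    simpa [sub_eq_zero] using hx
  have h3 := (absolutelyContinuous_tilted
    (integrable_exp_of_mem_paramSpace (interior_subset h))).ae_le h2
  exact h3

theorem hasDerivAt_logPartition (h : θ ∈ interior (paramSpace μ)) :
    HasDerivAt (logPartition μ) (logPartition' μ θ) θ :=
  (analyticAt_cgf (X := id) h).differentiableAt.hasDerivAt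

theorem hasDerivAt_logPartition' (h : θ ∈ interior (paramSpace μ)) :
    HasDerivAt (logPartition' μ) (logPartition'' μ θ) θ := by
  have h1 := (analyticAt_cgf (X := id) h).deriv.differentiableAt.hasDerivAt
  rw [logPartition'', iteratedDeriv_succ, iteratedDeriv_one]
  exact h1

/-- A midpoint bound for the log-partition function in terms of a bound on its second
derivative. -/
theorem logPartition_second_difference_le {s V : ℝ} (hs : 0 ≤ s)
    (hI : ∀ u ∈ Set.Icc θ (θ + 2 * s), u ∈ interior (paramSpace μ) ∧ logPartition'' μ u ≤ V) :
    logPartition μ (θ + 2 * s) - 2 * logPartition μ (θ + s) + logPartition μ θ ≤ V * s ^ 2 := by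
  -- Midpoint convexity of `V u² / 2 - A(u)` at the three equally spaced points is the claimed
  -- bound.
  have hconv : ConvexOn ℝ (Set.Icc θ (θ + 2 * s)) fun u => V / 2 * u ^ 2 - logPartition μ u := by
    refine convexOn_of_hasDerivWithinAt2_nonneg (convex_Icc _ _)
      (f' := fun u => V * u - logPartition' μ u) (f'' := fun u => V - logPartition'' μ u)
      ?_ ?_ ?_ ?_
    · intro u hu
      exact (((continuous_const.mul (continuous_id.pow 2)).continuousAt).sub
        (hasDerivAt_logPartition (hI u hu).1).continuousAt).continuousWithinAt
    · intro u hu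
      refine HasDerivAt.hasDerivWithinAt ?_
      have := (((hasDerivAt_id u).pow 2).const_mul (V / 2)).sub
        (hasDerivAt_logPartition (hI u (interior_subset hu)).1)
      convert! this using 1
      simp
      ring
    · intro u hu
      refine HasDerivAt.hasDerivWithinAt ?_
      have := ((hasDerivAt_id u).const_mul V).sub
        (hasDerivAt_logPartition' (hI u (interior_subset hu)).1)
      convert! this using 1
      simp
    · intro u hu
      linarith [(hI u (interior_subset hu)).2]
  have h := hconv.2 (Set.left_mem_Icc.2 (by linarith)) (Set.right_mem_Icc.2 (by linarith))
    (show (0 : ℝ) ≤ 1 / 2 by norm_num) (show (0 : ℝ) ≤ 1 / 2 by norm_num) (by norm_num)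
  simp only [smul_eq_mul] at h
  have hmid : 1 / 2 * θ + 1 / 2 * (θ + 2 * s) = θ + s := by ring
  rw [hmid] at h
  nlinarith

/-! ### Means of `[0, 1]`-valued functions along the family -/

section Weighted

variable {h : ℝ → ℝ}

theorem integrable_of_mem_unit {P : Measure ℝ} [IsFiniteMeasure P] (hh : Measurable h)
    (h01 : ∀ x, h x ∈ Set.Icc (0 : ℝ) 1) : Integrable h P := by
  refine Integrable.of_bound hh.aestronglyMeasurable 1 (ae_of_all _ fun x => ?_)
  rw [Real.norm_eq_abs, abs_of_nonneg (h01 x).1]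
  exact (h01 x).2

/-- The derivative of `u ↦ E_u h` is the covariance of `h` with the sufficient statistic. -/
theorem hasDerivAt_integral_expDist [NeZero μ] (hh : Measurable h)
    (h01 : ∀ x, h x ∈ Set.Icc (0 : ℝ) 1) (hu : u ∈ interior (paramSpace μ)) :
    HasDerivAt (fun t => ∫ x, h x ∂(expDist μ t))
      (∫ x, h x * (x - logPartition' μ u) ∂(expDist μ u)) u := by
  -- The mean of `h` under `P_t` is the quotient of the moment generating functions of `ν = h μ` and
  -- `μ`, so the quotient rule applies. Since `0 ≤ h ≤ 1`, the first is finite wherever the second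
  -- is.
  set ν := μ.withDensity fun x => ENNReal.ofReal (h x)
  have hsub : integrableExpSet id μ ⊆ integrableExpSet id ν := by
    intro t ht
    have ht' : Integrable (fun x => Real.exp (t * x)) μ := ht
    change Integrable (fun x => Real.exp (t * x)) ν
    rw [integrable_withDensity_iff_integrable_smul₀' (by fun_prop) (by simp)]
    refine ht'.mono (by fun_prop) (ae_of_all _ fun x => ?_)
    rw [norm_smul, ENNReal.toReal_ofReal (h01 x).1, Real.norm_eq_abs (h x),
      abs_of_nonneg (h01 x).1]
    exact mul_le_of_le_one_left (norm_nonneg _) (h01 x).2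
  have hint : ∀ g : ℝ → ℝ, ∫ x, g x ∂ν = ∫ x, h x * g x ∂μ := by
    intro g
    rw [integral_withDensity_eq_integral_toReal_smul (by fun_prop) (by simp)]
    refine integral_congr_ae (ae_of_all _ fun x => ?_)
    simp [ENNReal.toReal_ofReal (h01 x).1]
  have hE : ∀ (t : ℝ) (g : ℝ → ℝ),
      ∫ x, g x ∂(expDist μ t) = (∫ x, g x * Real.exp (t * x) ∂μ) / mgf id μ t := by
    intro t g
    have := integral_tilted_mul_eq_mgf (X := id) (t := t) (μ := μ) g
    simp only [id] at this
    rw [expDist, this, ← integral_div]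
    refine integral_congr_ae (ae_of_all _ fun x => ?_)
    simp only [smul_eq_mul]
    ring
  have hfun : (fun t => ∫ x, h x ∂(expDist μ t)) = fun t => mgf id ν t / mgf id μ t := by
    ext t
    rw [hE, mgf.eq_def id ν, hint]
    rfl
  have hpos : 0 < mgf id μ u := mgf_pos' (NeZero.ne μ) (interior_subset (s := paramSpace μ) hu)
  have hd := (hasDerivAt_mgf (interior_mono hsub hu)).div (hasDerivAt_mgf (X := id) hu) hpos.ne'
  rw [hfun]
  convert! hd using 1
  have := isProbabilityMeasure_expDist (interior_subset hu)
  have hi : Integrable (fun x => h x * x) (expDist μ u) := by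
    have h1 := integrable_sub_pow_expDist hu 0 1
    simp only [sub_zero, pow_one] at h1
    refine h1.mono (by fun_prop) (ae_of_all _ fun x => ?_)
    rw [norm_mul, Real.norm_eq_abs (h x), abs_of_nonneg (h01 x).1]
    exact mul_le_of_le_one_left (norm_nonneg _) (h01 x).2
  have e1 : ∫ x, h x * (x - logPartition' μ u) ∂(expDist μ u)
      = ∫ x, h x * x ∂(expDist μ u) - (∫ x, h x ∂(expDist μ u)) * ∫ x, x ∂(expDist μ u) := by
    rw [integral_id_expDist hu, ← integral_mul_const, ← integral_sub hi
      ((integrable_of_mem_unit hh h01).mul_const _)]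
    refine integral_congr_ae (ae_of_all _ fun x => ?_)
    ring
  rw [e1, hE, hE, hE, hint]
  have e2 : mgf id ν u = ∫ x, h x * Real.exp (u * x) ∂μ := by
    rw [mgf, hint]; rfl
  have e3 : ∫ x, h x * x * Real.exp (u * x) ∂μ = ∫ x, h x * (id x * Real.exp (u * id x)) ∂μ := by
    refine integral_congr_ae (ae_of_all _ fun x => ?_)
    simp only [id]
    ring
  rw [e2, ← e3]
  simp only [id]
  generalize ∫ x, h x * x * Real.exp (u * x) ∂μ = I
  field_simp

/-- This is Chebyshev's association inequality for `h` and the increasing weight `exp (t x)`. It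
needs no differentiability, so `θ'` may be a boundary point of the parameter space. -/
theorem integral_expDist_mono [NeZero μ] (hh : Monotone h)
    (h01 : ∀ x, h x ∈ Set.Icc (0 : ℝ) 1) (hθ : θ ∈ paramSpace μ) (hθ' : θ' ∈ paramSpace μ)
    (hle : θ ≤ θ') : ∫ x, h x ∂(expDist μ θ) ≤ ∫ x, h x ∂(expDist μ θ') := by
  rcases hle.eq_or_lt with rfl | hlt
  · exact le_rfl
  obtain ⟨t, rfl⟩ : ∃ t, θ' = θ + t := ⟨θ' - θ, by ring⟩
  have ht : 0 < t := by linarith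
  have := isProbabilityMeasure_expDist hθ
  have hw := integrable_exp_expDist hθ hθ'
  set P := expDist μ θ
  set W := ∫ x, Real.exp (t * x) ∂P
  have hW : 0 < W := integral_exp_pos hw
  -- The point where the weight equals its mean `W`. The factors `h x - h x₀` and `exp (t x) - W`
  -- then have the same sign everywhere.
  set x₀ := Real.log W / t
  have hx₀ : Real.exp (t * x₀) = W := by
    rw [show t * x₀ = Real.log W by simp only [x₀]; field_simp, Real.exp_log hW]
  have hhi : Integrable h P := integrable_of_mem_unit hh.measurable h01
  have hhw : Integrable (fun x => Real.exp (t * x) * h x) P := by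
    refine hw.mono (hw.1.mul hhi.1) (ae_of_all _ fun x => ?_)
    rw [norm_mul, Real.norm_eq_abs (h x), abs_of_nonneg (h01 x).1]
    exact mul_le_of_le_one_right (norm_nonneg _) (h01 x).2
  have hpt : ∀ x, h x₀ * Real.exp (t * x) + (h x * W - h x₀ * W) ≤ Real.exp (t * x) * h x := by
    intro x
    have : 0 ≤ (h x - h x₀) * (Real.exp (t * x) - W) := by
      rw [← hx₀]
      rcases le_total x₀ x with hx | hx
      · exact mul_nonneg (sub_nonneg.2 (hh hx)) (sub_nonneg.2 (Real.exp_le_exp.2 (by nlinarith)))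
      · exact mul_nonneg_of_nonpos_of_nonpos (sub_nonpos.2 (hh hx))
          (sub_nonpos.2 (Real.exp_le_exp.2 (by nlinarith)))
    nlinarith
  have hhi' : Integrable (fun x => h x * W - h x₀ * W) P :=
    (hhi.mul_const W).sub (integrable_const _)
  have hint := integral_mono ((hw.const_mul (h x₀)).add hhi') hhw hpt
  simp only [Pi.add_apply] at hint
  rw [integral_add (hw.const_mul _) hhi', integral_sub (hhi.mul_const W) (integrable_const _), integral_const_mul,
    integral_mul_const] at hint
  simp only [integral_const, probReal_univ, smul_eq_mul, one_mul] at hint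
  have hEq : ∫ x, h x ∂(expDist μ (θ + t)) = (∫ x, Real.exp (t * x) * h x ∂P) / W := by
    rw [← tilted_expDist hθ, integral_tilted, ← integral_div]
    refine integral_congr_ae (ae_of_all _ fun x => ?_)
    simp only [smul_eq_mul]
    ring
  rw [hEq, le_div_iff₀ hW]
  change h x₀ * W + _ ≤ _ at hint
  linarith

end Weighted

end ExponentialFamily

/-! ### Separating and non-separable alternatives -/

section Separation

variable {μ : Measure ℝ} {θ θ' u : ℝ}

/-- The piecewise linear function that rises from `0` at `m - B` to `1` at `m + B`. -/
noncomputable def ramp (m B x : ℝ) : ℝ := max 0 (min 1 ((x - m + B) / (2 * B)))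

theorem ramp_mem (m B x : ℝ) : ramp m B x ∈ Set.Icc (0 : ℝ) 1 :=
  ⟨le_max_left _ _, max_le zero_le_one (min_le_left _ _)⟩

theorem monotone_ramp (m : ℝ) {B : ℝ} (hB : 0 < B) : Monotone (ramp m B) := by
  intro x y hxy
  unfold ramp
  gcongr

/-- On its linear piece the ramp gives the quadratic part exactly. Where it is clipped, `|d| ≤ B /
2` forces `|y| ≥ B / 2`, and the quartic term outweighs the quadratic one. Under `P_u`, with `y` the
deviation from the mean, the linear term integrates to zero. -/
theorem ramp_mul_lower_bound {B d y : ℝ} (m : ℝ) (hB : 0 < B) (hd : |d| ≤ B / 2) :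
    1 / (2 * B) * (y ^ 2 + (d + B) * y - 8 / B ^ 2 * y ^ 4) ≤ ramp m B (m + d + y) * y := by
  have harg : (m + d + y - m + B) / (2 * B) = (d + y + B) / (2 * B) := by ring_nf
  have hd' := abs_le.1 hd
  have hy4 : 0 ≤ y ^ 4 := by positivity
  have hcoef : 0 ≤ 8 / B ^ 2 * y ^ 4 := by positivity
  have hlarge : B / 2 ≤ |y| → 2 * y ^ 2 ≤ 8 / B ^ 2 * y ^ 4 := by
    intro hy
    have h1 : B ^ 2 ≤ 4 * y ^ 2 := by
      rw [← sq_abs y]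
      nlinarith
    rw [div_mul_eq_mul_div, le_div_iff₀ (by positivity)]
    nlinarith [sq_nonneg y]
  have hscale : ∀ z w : ℝ, z ≤ 2 * B * w → 1 / (2 * B) * z ≤ w := by
    intro z w h
    rw [one_div, inv_mul_le_iff₀ (by positivity)]
    exact h
  apply hscale
  unfold ramp
  rw [harg]
  rcases le_total (d + y) (-B) with h1 | h1
  · have : (d + y + B) / (2 * B) ≤ 0 := div_nonpos_of_nonpos_of_nonneg (by linarith) (by linarith)
    rw [max_eq_left ((min_le_right _ _).trans this)]
    have hy : y ≤ -(B / 2) := by linarith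
    have := hlarge (by rw [abs_of_neg (by linarith)]; linarith)
    nlinarith
  · rcases le_total (d + y) B with h2 | h2
    · have h3 : (d + y + B) / (2 * B) ≤ 1 := by
        rw [div_le_one (by positivity)]; linarith
      have h4 : 0 ≤ (d + y + B) / (2 * B) := div_nonneg (by linarith) (by linarith)
      rw [min_eq_right h3, max_eq_right h4, ← mul_assoc, mul_div_cancel₀ _ (by positivity)]
      nlinarith
    · have : 1 ≤ (d + y + B) / (2 * B) := by
        rw [le_div_iff₀ (by positivity)]; linarith
      rw [min_eq_left this, max_eq_right zero_le_one]
      have hy : B / 2 ≤ y := by linarith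
      have := hlarge (by rw [abs_of_nonneg (by linarith)]; linarith)
      nlinarith

/-- The covariance of a ramp with the sufficient statistic is large when the fourth moment is
controlled. -/
theorem covariance_ramp_lower_bound [NeZero μ] {m B ζ : ℝ} (hu : u ∈ interior (paramSpace μ))
    (hV : 0 < logPartition'' μ u) (hB : 0 < B) (hd : |logPartition' μ u - m| ≤ B / 2)
    (hk : kurtosis μ u ≤ ζ) :
    1 / (2 * B) * (logPartition'' μ u - 8 / B ^ 2 * (ζ * logPartition'' μ u ^ 2)) ≤
      ∫ x, ramp m B x * (x - logPartition' μ u) ∂(expDist μ u) := by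
  have := isProbabilityMeasure_expDist (interior_subset hu)
  set a := logPartition' μ u
  have i1 : Integrable (fun x => x - a) (expDist μ u) := by
    simpa using integrable_sub_pow_expDist hu a 1
  have i2 := integrable_sub_pow_expDist hu a 2
  have i4 := integrable_sub_pow_expDist hu a 4
  have hm0 : ∫ x, (x - a) ∂(expDist μ u) = 0 := by
    have : Integrable (fun x => x) (expDist μ u) := by
      simpa using integrable_sub_pow_expDist hu 0 1
    rw [integral_sub this (integrable_const _), integral_id_expDist hu]
    simp [a]
  have hm4 : ∫ x, (x - a) ^ 4 ∂(expDist μ u) ≤ ζ * logPartition'' μ u ^ 2 := by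
    rw [kurtosis, div_le_iff₀ (by positivity)] at hk
    exact hk
  have hmeas : Measurable (ramp m B) := (monotone_ramp m hB).measurable
  have ir : Integrable (fun x => ramp m B x * (x - a)) (expDist μ u) := by
    refine i1.mono (by fun_prop) (ae_of_all _ fun x => ?_)
    rw [norm_mul, Real.norm_eq_abs (ramp m B x), abs_of_nonneg (ramp_mem m B x).1]
    exact mul_le_of_le_one_left (norm_nonneg _) (ramp_mem m B x).2
  have i12 : Integrable (fun x => (x - a) ^ 2 + (a - m + B) * (x - a)) (expDist μ u) :=
    i2.add (i1.const_mul _)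
  have hint := integral_mono ((i12.sub (i4.const_mul (8 / B ^ 2))).const_mul (1 / (2 * B))) ir
    fun x => by
      have := ramp_mul_lower_bound (y := x - a) m hB hd
      simpa using this
  refine le_trans ?_ hint
  simp only [Pi.sub_apply]
  rw [integral_const_mul, integral_sub i12 (i4.const_mul _), integral_add i2 (i1.const_mul _),
    integral_const_mul, integral_const_mul, hm0, integral_sub_sq_expDist hu]
  rw [mul_zero, add_zero]
  gcongr

/-- Strictness matters: the supremum defining `kappa` need not be attained. Later arguments
therefore stay within half of the assumed radius. -/
theorem mem_interior_of_lt_kappa (h : ENNReal.ofReal |u - θ| < kappa μ θ) :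
    u ∈ interior (paramSpace μ) ∧
      logPartition'' μ θ / logPartition'' μ u ∈ Set.Icc (1 / 2 : ℝ) 2 := by
  obtain ⟨r, hr, hlt⟩ := lt_sSup_iff.1 h
  exact hr u hlt.le

theorem logPartition''_mem_of_lt_kappa (hμ : ∀ a : ℝ, μ {a}ᶜ ≠ 0)
    (h : ENNReal.ofReal |u - θ| < kappa μ θ) :
    logPartition'' μ θ / 2 ≤ logPartition'' μ u ∧
      logPartition'' μ u ≤ 2 * logPartition'' μ θ := by
  obtain ⟨hu, h1, h2⟩ := mem_interior_of_lt_kappa h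
  have hpos := logPartition''_pos hμ hu
  rw [le_div_iff₀ hpos] at h1
  rw [div_le_iff₀ hpos] at h2
  constructor <;> linarith

theorem abs_logPartition'_sub_le (hμ : ∀ a : ℝ, μ {a}ᶜ ≠ 0)
    {r : ℝ} (hr : ENNReal.ofReal r < kappa μ θ) (hur : |u - θ| ≤ r) :
    |logPartition' μ u - logPartition' μ θ| ≤ 2 * logPartition'' μ θ * |u - θ| := by
  have hin : ∀ w ∈ Set.uIcc θ u, ENNReal.ofReal |w - θ| < kappa μ θ := fun w hw =>
    (ENNReal.ofReal_le_ofReal ((Set.abs_sub_left_of_mem_uIcc hw).trans hur)).trans_lt hr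
  have := (convex_uIcc θ u).norm_image_sub_le_of_norm_hasDerivWithin_le
    (f := logPartition' μ) (f' := logPartition'' μ) (C := 2 * logPartition'' μ θ)
    (fun w hw => (hasDerivAt_logPartition'
      (mem_interior_of_lt_kappa (hin w hw)).1).hasDerivWithinAt)
    (fun w hw => by
      rw [Real.norm_eq_abs, abs_of_pos (logPartition''_pos hμ
        (mem_interior_of_lt_kappa (hin w hw)).1)]
      exact (logPartition''_mem_of_lt_kappa hμ (hin w hw)).2)
    Set.left_mem_uIcc Set.right_mem_uIcc
  simpa only [Real.norm_eq_abs] using this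

/-- Far enough from `θ`, the mean of a suitable `[0, 1]`-valued function changes by at least
`12 / √n`. -/
theorem exists_separating_function (hμ : ∀ a : ℝ, μ {a}ᶜ ≠ 0) {ζ C : ℝ} {n : ℕ} (hζ : 0 < ζ)
    (hC : C = 192 * (2 + 32 * ζ)) (hn : C ^ 2 ≤ n) (hθ : θ ∈ interior (paramSpace μ))
    (hkurt : ∀ θ' ∈ smoothInterval μ θ, kurtosis μ θ' ≤ ζ)
    (hkap : ENNReal.ofReal (C / √((n : ℝ) * logPartition'' μ θ)) ≤ kappa μ θ)
    (hθ' : θ' ∈ paramSpace μ) (hfar : C / √((n : ℝ) * logPartition'' μ θ) < |θ - θ'|) :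
    ∃ h : ℝ → ℝ, Measurable h ∧ (∀ x, h x ∈ Set.Icc (0 : ℝ) 1) ∧
      ∫ x, h x ∂(expDist μ θ) + 12 / √n ≤ ∫ x, h x ∂(expDist μ θ') := by
  have := neZero_of_forall_compl_ne_zero hμ
  have hV := logPartition''_pos hμ hθ
  set V := logPartition'' μ θ
  set σ := √V
  have hσ : 0 < σ := Real.sqrt_pos.2 hV
  have hσ2 : σ * σ = V := Real.mul_self_sqrt hV.le
  -- The ramp's half-width in standard deviations. `R ≥ 2` leaves room for the mean to drift by one
  -- standard deviation, and `R² ≥ 32 ζ` makes the clipping loss at most half of the variance.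
  set R : ℝ := 2 + 32 * ζ
  have hR : 2 ≤ R := by simp only [R]; linarith
  have hRζ : 32 * ζ ≤ R ^ 2 := by simp only [R]; nlinarith
  have hC0 : 0 < C := by rw [hC]; positivity
  have hCn : C ≤ √(n : ℝ) := Real.le_sqrt_of_sq_le hn
  have hsn : 0 < √(n : ℝ) := hC0.trans_le hCn
  rw [Real.sqrt_mul (Nat.cast_nonneg n)] at hkap hfar
  set B := R * σ
  have hB : 0 < B := by positivity
  set m := logPartition' μ θ
  set s := C / (√n * σ) / 2
  have hs : 0 < s := by positivity
  have hsk : ENNReal.ofReal s < kappa μ θ := by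
    refine lt_of_lt_of_le ((ENNReal.ofReal_lt_ofReal_iff (by positivity)).2 ?_) hkap
    exact half_lt_self (by positivity)
  have hloc : ∀ w, |w - θ| ≤ s → w ∈ interior (paramSpace μ) ∧
      σ / (8 * R) ≤ ∫ x, ramp m B x * (x - logPartition' μ w) ∂(expDist μ w) := by
    intro w hw
    have hwk : ENNReal.ofReal |w - θ| < kappa μ θ :=
      (ENNReal.ofReal_le_ofReal hw).trans_lt hsk
    obtain ⟨hwi, -⟩ := mem_interior_of_lt_kappa hwk
    obtain ⟨hv1, hv2⟩ := logPartition''_mem_of_lt_kappa hμ hwk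
    refine ⟨hwi, ?_⟩
    -- The mean drifts by at most `2 V s = σ C / √n ≤ σ`; this is where `C² ≤ n` is needed.
    have hd : |logPartition' μ w - m| ≤ B / 2 := by
      refine (abs_logPartition'_sub_le hμ hsk hw).trans ?_
      calc 2 * V * |w - θ| ≤ 2 * V * s := by gcongr
        _ = σ * (C / √n) := by simp only [s]; rw [← hσ2]; field_simp
        _ ≤ σ * 1 := by gcongr; exact (div_le_one hsn).2 hCn
        _ ≤ B / 2 := by simp only [B]; nlinarith
    refine le_trans ?_ (covariance_ramp_lower_bound hwi (logPartition''_pos hμ hwi) hB hd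
      (hkurt w ⟨hwi, hwk.le⟩))
    set v := logPartition'' μ w
    have hv : 0 < v := by linarith
    have hB2 : B ^ 2 = R ^ 2 * V := by simp only [B]; rw [← hσ2]; ring
    have h1 : 8 / B ^ 2 * (ζ * v ^ 2) ≤ v / 2 := by
      rw [div_mul_eq_mul_div, div_le_iff₀ (by positivity), hB2]
      have : 16 * ζ * v ≤ R ^ 2 * V := by nlinarith
      nlinarith
    calc σ / (8 * R) = 1 / (2 * B) * (V / 4) := by
          simp only [B]; rw [← hσ2]; field_simp; norm_num
      _ ≤ 1 / (2 * B) * (v - 8 / B ^ 2 * (ζ * v ^ 2)) := by gcongr; linarith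
  set H : ℝ → ℝ := fun t => ∫ x, ramp m B x ∂(expDist μ t)
  have hmono := monotone_ramp m hB
  have hderiv : ∀ w, |w - θ| ≤ s → HasDerivAt H
      (∫ x, ramp m B x * (x - logPartition' μ w) ∂(expDist μ w)) w := fun w hw =>
    hasDerivAt_integral_expDist hmono.measurable (ramp_mem m B) (hloc w hw).1
  have hmvt : ∀ a b, |a - θ| ≤ s → |b - θ| ≤ s → a ≤ b → σ / (8 * R) * (b - a) ≤ H b - H a := by
    intro a b ha hb hab
    have hin : ∀ w ∈ Set.Icc a b, |w - θ| ≤ s := by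
      intro w hw
      rw [abs_le] at *
      exact ⟨by linarith [hw.1], by linarith [hw.2]⟩
    refine (convex_Icc a b).mul_sub_le_image_sub_of_le_deriv
      (fun w hw => (hderiv w (hin w hw)).continuousAt.continuousWithinAt)
      (fun w hw => (hderiv w (hin w (interior_subset hw))).differentiableAt.differentiableWithinAt)
      (fun w hw => ?_) a ⟨le_rfl, hab⟩ b ⟨hab, le_rfl⟩ hab
    rw [(hderiv w (hin w (interior_subset hw))).deriv]
    exact (hloc w (hin w (interior_subset hw))).2
  -- The slope times the distance `s` is `C / (16 R √n)`, so `C = 192 R` gives exactly the gap that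
  -- the logistic test needs.
  have hgap : σ / (8 * R) * s = 12 / √n := by
    simp only [s]
    rw [hC]
    field_simp
    norm_num
  have habs0 : |θ - θ| ≤ s := by simpa using hs.le
  have hfar' : s < |θ - θ'| := lt_trans (half_lt_self (by positivity)) hfar
  -- The gap is earned between `θ` and `θ ± s`, and monotonicity carries it on to `θ'`. To the left
  -- of `θ` the ramp is reflected so that the alternative has the larger mean.
  rcases lt_abs.1 hfar' with h | h
  · refine ⟨fun x => 1 - ramp m B x, hmono.measurable.const_sub 1, fun x => ?_, ?_⟩
    · have := ramp_mem m B x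
      simp only [Set.mem_Icc] at *
      constructor <;> linarith
    · have habs : |θ - s - θ| ≤ s := by
        rw [show θ - s - θ = -s by ring, abs_neg, abs_of_pos hs]
      have h1 := hmvt (θ - s) θ habs habs0 (by linarith)
      rw [show θ - (θ - s) = s by ring, hgap] at h1
      have h2 : H θ' ≤ H (θ - s) := integral_expDist_mono hmono (ramp_mem m B) hθ'
        (interior_subset (hloc _ habs).1) (by linarith)
      have := isProbabilityMeasure_expDist (interior_subset hθ)
      have := isProbabilityMeasure_expDist hθ'
      rw [integral_sub (integrable_const _) (integrable_of_mem_unit hmono.measurable (ramp_mem m B)),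
        integral_sub (integrable_const _) (integrable_of_mem_unit hmono.measurable (ramp_mem m B))]
      simp only [integral_const, probReal_univ, smul_eq_mul, one_mul]
      change 1 - H θ + _ ≤ 1 - H θ'
      linarith
  · refine ⟨ramp m B, hmono.measurable, ramp_mem m B, ?_⟩
    have habs : |θ + s - θ| ≤ s := by rw [add_sub_cancel_left, abs_of_pos hs]
    have h1 := hmvt θ (θ + s) habs0 habs (by linarith)
    rw [add_sub_cancel_left, hgap] at h1
    have h2 : H (θ + s) ≤ H θ' := integral_expDist_mono hmono (ramp_mem m B)
      (interior_subset (hloc _ habs).1) hθ' (by linarith)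
    change H θ + _ ≤ H θ'
    linarith

/-- Two members of the family at distance `1 / (4 √(n A''(θ)))` cannot be told apart with `n`
samples. -/
theorem not_separated_expDist (hμ : ∀ a : ℝ, μ {a}ᶜ ≠ 0) {n : ℕ} (hn : 0 < n)
    (hθ : θ ∈ interior (paramSpace μ))
    (hkap : ENNReal.ofReal (1 / √((n : ℝ) * logPartition'' μ θ)) ≤ kappa μ θ) :
    ∃ θ' ∈ paramSpace μ, |θ - θ'| = 1 / 4 / √((n : ℝ) * logPartition'' μ θ) ∧ θ ≤ θ' ∧
      ∀ {Y : Type} [MeasurableSpace Y] (M : Mechanism ℝ Y) (E : Set Y), MeasurableSet E →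
        ¬ (3 / 4 ≤ M.outputLaw n (expDist μ θ) Eᶜ ∧ 3 / 4 ≤ M.outputLaw n (expDist μ θ') E) := by
  have := neZero_of_forall_compl_ne_zero hμ
  have hV := logPartition''_pos hμ hθ
  set V := logPartition'' μ θ
  have hn' : (0 : ℝ) < n := by exact_mod_cast hn
  have hsq : 0 < √((n : ℝ) * V) := Real.sqrt_pos.2 (by positivity)
  set s := 1 / 4 / √((n : ℝ) * V)
  have hs : 0 < s := by positivity
  -- The exponent of the second moment of the likelihood ratio of the `n`-fold products is at most
  -- this, and `exp (1/8) ≤ 8/7 < 5/4`.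
  have hs2 : n * (2 * V * s ^ 2) = 1 / 8 := by
    simp only [s]
    rw [div_pow, Real.sq_sqrt (by positivity)]
    field_simp
    norm_num
  have hin : ∀ u ∈ Set.Icc θ (θ + 2 * s),
      u ∈ interior (paramSpace μ) ∧ logPartition'' μ u ≤ 2 * V := by
    intro u hu
    have hk : ENNReal.ofReal |u - θ| < kappa μ θ := by
      refine lt_of_lt_of_le ((ENNReal.ofReal_lt_ofReal_iff (by positivity)).2 ?_) hkap
      rw [abs_of_nonneg (by linarith [hu.1])]
      have : 1 / √((n : ℝ) * V) = 4 * s := by simp only [s]; ring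
      rw [this]
      linarith [hu.2]
    exact ⟨(mem_interior_of_lt_kappa hk).1, (logPartition''_mem_of_lt_kappa hμ hk).2⟩
  have hmem : θ ∈ paramSpace μ := interior_subset hθ
  have hmem1 : θ + s ∈ paramSpace μ := interior_subset (hin _ ⟨by linarith, by linarith⟩).1
  have hmem2 : θ + 2 * s ∈ paramSpace μ := interior_subset (hin _ ⟨by linarith, by linarith⟩).1
  refine ⟨θ + s, hmem1, ?_, by linarith, ?_⟩
  · rw [sub_add_cancel_left, abs_neg, abs_of_pos hs]
  intro Y _ M E hE
  have hP := isProbabilityMeasure_expDist hmem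
  have hQ := isProbabilityMeasure_expDist hmem1
  rw [← expDist_withDensity hmem hmem1] at hQ ⊢
  refine not_separated_of_lintegral_sq_lt (measurable_likelihoodRatio μ θ s) ?_ M hE
  rw [lintegral_likelihoodRatio_sq hmem hmem2, ← ENNReal.ofReal_pow (Real.exp_nonneg _),
    ← Real.exp_nat_mul]
  have h54 : (5 / 4 : ℝ≥0∞) = ENNReal.ofReal (5 / 4) := by
    rw [ENNReal.ofReal_div_of_pos (by norm_num)]; simp
  rw [h54, ENNReal.ofReal_lt_ofReal_iff (by norm_num)]
  have hle : n * (logPartition μ (θ + 2 * s) - 2 * logPartition μ (θ + s) + logPartition μ θ)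
      ≤ 1 / 8 := by
    rw [← hs2]
    exact mul_le_mul_of_nonneg_left (logPartition_second_difference_le hs.le hin) hn'.le
  refine (Real.exp_le_exp.2 hle).trans_lt ?_
  have := Real.exp_bound_div_one_sub_of_interval (x := 1 / 8) (by norm_num) (by norm_num)
  refine lt_of_le_of_lt this (by norm_num)

end Separation

/-! ### Monotonicity of the modulus and the local rate; bounds on sample complexity -/

section Rates

variable {χ : Type*} [MeasurableSpace χ]

theorem thresholdTest_outputLaw_apply (f : Estimator χ) (τ : ℝ) (n : ℕ) (P : Measure χ)
    {S : Set Bool} (hS : MeasurableSet S) :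
    (thresholdTest f τ).outputLaw n P S =
      f.outputLaw n P ((fun y => decide (τ ≤ y)) ⁻¹' S) := by
  rw [Mechanism.outputLaw_apply _ _ _ hS,
    Mechanism.outputLaw_apply _ _ _ (measurable_decide_le τ hS)]
  refine lintegral_congr fun d => ?_
  exact Kernel.map_apply' (f.kernel n) (measurable_decide_le τ) d hS

theorem testClass_mono {F F' : Set (Estimator χ)} (h : F ⊆ F') : testClass F ⊆ testClass F' :=
  fun _ ⟨f, hf, τ, hT⟩ => ⟨f, h hf, τ, hT⟩

theorem classSampleComplexity_anti {G G' : Set (BinaryTest χ)} (h : G ⊆ G') (P Q : Measure χ) :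
    classSampleComplexity G' P Q ≤ classSampleComplexity G P Q :=
  biInf_mono fun _ hT => h hT

theorem modulus_anti {G G' : Set (BinaryTest χ)} (h : G ⊆ G') (n : ℕ) (P : Measure χ)
    (Fam : Set (Measure χ)) (t : Measure χ → ℝ) : modulus n P G' Fam t ≤ modulus n P G Fam t := by
  refine iSup_mono fun Q => iSup_mono fun _ => iSup_mono' fun hQ => ?_
  exact ⟨hQ.trans_le (classSampleComplexity_anti h P Q), le_rfl⟩

theorem localRate_anti {F F' : Set (Estimator χ)} (h : F ⊆ F') (n : ℕ) (P : Measure χ)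
    (Fam : Set (Measure χ)) (t : Measure χ → ℝ) :
    localRate n P Fam F' t ≤ localRate n P Fam F t :=
  iSup₂_mono fun _ _ => biInf_mono fun _ hf => h hf

/-- A complexity of at most `n` would require success at `n` itself. Passing through `n + 1 ≤` keeps
the inequality strict under the infimum over tests. -/
theorem lt_classSampleComplexity {G : Set (BinaryTest χ)} {P Q : Measure χ} {n : ℕ}
    (h : ∀ T ∈ G, ¬ Distinguishes T P Q n) : (n : ℕ∞) < classSampleComplexity G P Q := by
  have h1 : ((n + 1 : ℕ) : ℕ∞) ≤ classSampleComplexity G P Q := by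
    refine le_iInf₂ fun T hT => le_iInf₂ fun m hm => ?_
    by_contra hcon
    have : m < n + 1 := by exact_mod_cast not_le.1 hcon
    exact h T hT (hm n (by omega))
  exact lt_of_lt_of_le (by exact_mod_cast n.lt_succ_self) h1

theorem classSampleComplexity_le {G : Set (BinaryTest χ)} {P Q : Measure χ} {n : ℕ}
    {T : BinaryTest χ} (hT : T ∈ G) (h : ∀ N, n ≤ N → Distinguishes T P Q N) :
    classSampleComplexity G P Q ≤ n :=
  (iInf₂_le T hT).trans (iInf₂_le n h)

theorem measurableSet_ofReal_abs_sub_le (t : ℝ) (r : ℝ≥0∞) :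
    MeasurableSet {y : ℝ | ENNReal.ofReal |y - t| ≤ r} :=
  measurableSet_le (by fun_prop) measurable_const

theorem errorRate_le {f : Estimator χ} {n : ℕ} {P : Measure χ} {t : Measure χ → ℝ} {r : ℝ≥0∞}
    (h : 3 / 4 ≤ f.outputLaw n P {y | ENNReal.ofReal |y - t P| ≤ r}) : errorRate f n P t ≤ r :=
  sInf_le h

end Rates

/-! ### Lower and upper bounds for the modulus and the local rate -/

section ExponentialFamily

variable {μ : Measure ℝ} {θ θ' : ℝ}

theorem expDist_mem_expFamily (h : θ ∈ paramSpace μ) : expDist μ θ ∈ expFamily μ :=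
  Set.mem_image_of_mem _ h

theorem le_modulus_allEstimators (hμ : ∀ a : ℝ, μ {a}ᶜ ≠ 0) {n : ℕ} (hn : 0 < n)
    (hθ : θ ∈ interior (paramSpace μ))
    (hkap : ENNReal.ofReal (1 / √((n : ℝ) * logPartition'' μ θ)) ≤ kappa μ θ) :
    ENNReal.ofReal (1 / 4 / √((n : ℝ) * logPartition'' μ θ)) ≤
      modulus n (expDist μ θ) (testClass (allEstimators ℝ)) (expFamily μ) (expParam μ) := by
  obtain ⟨θ', hθ', hdist, -, hsep⟩ := not_separated_expDist hμ hn hθ hkap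
  rw [← hdist]
  refine le_trans (le_of_eq ?_) (le_iSup_of_le (expDist μ θ')
    (le_iSup₂_of_le (expDist_mem_expFamily hθ') (lt_classSampleComplexity fun T _ hT => ?_) le_rfl))
  · rw [expParam_expDist μ hμ θ (interior_subset hθ), expParam_expDist μ hμ θ' hθ']
  · refine hsep T {true} (measurableSet_singleton _) ⟨?_, hT.2⟩
    have : ({true} : Set Bool)ᶜ = {false} := by ext b; cases b <;> simp
    rw [this]
    exact hT.1

theorem le_localRate_allEstimators (hμ : ∀ a : ℝ, μ {a}ᶜ ≠ 0) {n : ℕ} (hn : 0 < n)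
    (hθ : θ ∈ interior (paramSpace μ))
    (hkap : ENNReal.ofReal (1 / √((n : ℝ) * logPartition'' μ θ)) ≤ kappa μ θ) :
    ENNReal.ofReal (1 / 4 / (2 * √((n : ℝ) * logPartition'' μ θ))) ≤
      localRate n (expDist μ θ) (expFamily μ) (allEstimators ℝ) (expParam μ) := by
  obtain ⟨θ', hθ', hdist, hle, hsep⟩ := not_separated_expDist hμ hn hθ hkap
  refine le_iSup₂_of_le (expDist μ θ') (expDist_mem_expFamily hθ') (le_iInf₂ fun f _ => ?_)
  by_contra hcon
  obtain ⟨h1, h2⟩ := max_lt_iff.1 (not_le.1 hcon)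
  have hhalf : 1 / 4 / (2 * √((n : ℝ) * logPartition'' μ θ)) = (θ' - θ) / 2 := by
    rw [abs_sub_comm, abs_of_nonneg (sub_nonneg.2 hle)] at hdist
    rw [hdist]
    ring
  rw [hhalf] at h1 h2
  obtain ⟨r₁, hr₁, hlt₁⟩ := sInf_lt_iff.1 h1
  obtain ⟨r₂, hr₂, hlt₂⟩ := sInf_lt_iff.1 h2
  have hlt : ∀ {a : ℝ} {r : ℝ≥0∞}, ENNReal.ofReal a ≤ r → r < ENNReal.ofReal ((θ' - θ) / 2) →
      a < (θ' - θ) / 2 := fun ha hr => (ENNReal.ofReal_lt_ofReal_iff').1 (ha.trans_lt hr) |>.1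
  -- Errors below half the distance at both parameters would let thresholding at the midpoint
  -- separate the two laws.
  refine hsep f (Set.Ici ((θ + θ') / 2)) measurableSet_Ici
    ⟨hr₁.trans (measure_mono fun y hy => ?_), hr₂.trans (measure_mono fun y hy => ?_)⟩
  · have := (abs_lt.1 (hlt hy hlt₁)).2
    rw [expParam_expDist μ hμ θ (interior_subset hθ)] at this
    simp only [Set.compl_Ici, Set.mem_Iio]
    linarith
  · have := (abs_lt.1 (hlt hy hlt₂)).1
    rw [expParam_expDist μ hμ θ' hθ'] at this
    simp only [Set.mem_Ici]
    linarith

/-- Far enough from `θ`, some `ε`-differentially private estimator takes given values with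
probability `3 / 4` under `P_θ` and under the alternative, at all sample sizes from `n` on. -/
theorem exists_private_separating_estimator (hμ : ∀ a : ℝ, μ {a}ᶜ ≠ 0) {ζ C ε : ℝ} {n : ℕ}
    (hζ : 0 < ζ) (hC : C = 192 * (2 + 32 * ζ)) (hn : C ^ 2 ≤ n) (hε : 1 / √(n : ℝ) ≤ ε)
    (hθ : θ ∈ interior (paramSpace μ))
    (hkurt : ∀ θ' ∈ smoothInterval μ θ, kurtosis μ θ' ≤ ζ)
    (hkap : ENNReal.ofReal (C / √((n : ℝ) * logPartition'' μ θ)) ≤ kappa μ θ)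
    (hθ' : θ' ∈ paramSpace μ) (hfar : C / √((n : ℝ) * logPartition'' μ θ) < |θ - θ'|) (a b : ℝ) :
    ∃ f ∈ dpEstimators ℝ ε, ∀ N, n ≤ N → ∀ E : Set ℝ, MeasurableSet E →
      (a ∈ E → 3 / 4 ≤ f.outputLaw N (expDist μ θ) E) ∧
      (b ∈ E → 3 / 4 ≤ f.outputLaw N (expDist μ θ') E) := by
  have := neZero_of_forall_compl_ne_zero hμ
  have hP := isProbabilityMeasure_expDist (interior_subset hθ)
  have hQ := isProbabilityMeasure_expDist hθ'
  obtain ⟨h, hh, h01, hgap⟩ := exists_separating_function hμ hζ hC hn hθ hkurt hkap hθ' hfar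
  have hC0 : 0 < C := by rw [hC]; positivity
  have hsn : 0 < √(n : ℝ) := hC0.trans_le (Real.le_sqrt_of_sq_le hn)
  set p := ∫ x, h x ∂(expDist μ θ)
  set q := ∫ x, h x ∂(expDist μ θ')
  have hε0 : 0 < ε := lt_of_lt_of_le (by positivity) hε
  refine ⟨logisticEstimator h hh ((p + q) / 2) ε a b, logisticEstimator_isDP hh h01 _ hε0.le a b,
    fun N hN E hE => ?_⟩
  -- The gap and `ε` stay fixed while `√N` grows, so the accuracy conditions persist for all `N ≥
  -- n`, as the definition of sample complexity demands.
  have hsN : √(n : ℝ) ≤ √(N : ℝ) := Real.sqrt_le_sqrt (by exact_mod_cast hN)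
  have hδ : 12 ≤ √(N : ℝ) * (q - p) :=
    calc (12 : ℝ) = √n * (12 / √n) := by field_simp
      _ ≤ √N * (q - p) := by gcongr; linarith
  have hεN : 1 ≤ √(N : ℝ) * ε :=
    calc (1 : ℝ) = √n * (1 / √n) := by field_simp
      _ ≤ √N * ε := by gcongr
  exact ⟨fun ha => logisticEstimator_outputLaw_left hh h01 (by linarith) hδ hεN hE ha,
    fun hb => logisticEstimator_outputLaw_right hh h01 (by linarith) hδ hεN hE hb⟩

theorem modulus_dpEstimators_le (hμ : ∀ a : ℝ, μ {a}ᶜ ≠ 0) {ζ C ε : ℝ} {n : ℕ}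
    (hζ : 0 < ζ) (hC : C = 192 * (2 + 32 * ζ)) (hn : C ^ 2 ≤ n) (hε : 1 / √(n : ℝ) ≤ ε)
    (hθ : θ ∈ interior (paramSpace μ))
    (hkurt : ∀ θ' ∈ smoothInterval μ θ, kurtosis μ θ' ≤ ζ)
    (hkap : ENNReal.ofReal (C / √((n : ℝ) * logPartition'' μ θ)) ≤ kappa μ θ) :
    modulus n (expDist μ θ) (testClass (dpEstimators ℝ ε)) (expFamily μ) (expParam μ) ≤
      ENNReal.ofReal (C / √((n : ℝ) * logPartition'' μ θ)) := by
  refine iSup_le fun Q => iSup₂_le fun hQ hSC => ?_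
  obtain ⟨θ', hθ', rfl⟩ := hQ
  rw [expParam_expDist μ hμ θ (interior_subset hθ), expParam_expDist μ hμ θ' hθ']
  refine ENNReal.ofReal_le_ofReal (not_lt.1 fun hfar => hSC.not_ge ?_)
  obtain ⟨f, hf, hsep⟩ := exists_private_separating_estimator hμ hζ hC hn hε hθ hkurt hkap hθ'
    hfar 0 1
  refine classSampleComplexity_le (T := thresholdTest f (1 / 2)) ⟨f, hf, _, rfl⟩ fun N hN => ?_
  constructor
  · rw [thresholdTest_outputLaw_apply _ _ _ _ (measurableSet_singleton _)]
    exact (hsep N hN _ (measurable_decide_le _ (measurableSet_singleton _))).1 (by norm_num)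
  · rw [thresholdTest_outputLaw_apply _ _ _ _ (measurableSet_singleton _)]
    exact (hsep N hN _ (measurable_decide_le _ (measurableSet_singleton _))).2 (by norm_num)

theorem localRate_dpEstimators_le (hμ : ∀ a : ℝ, μ {a}ᶜ ≠ 0) {ζ C ε : ℝ} {n : ℕ}
    (hζ : 0 < ζ) (hC : C = 192 * (2 + 32 * ζ)) (hn : C ^ 2 ≤ n) (hε : 1 / √(n : ℝ) ≤ ε)
    (hθ : θ ∈ interior (paramSpace μ))
    (hkurt : ∀ θ' ∈ smoothInterval μ θ, kurtosis μ θ' ≤ ζ)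
    (hkap : ENNReal.ofReal (C / √((n : ℝ) * logPartition'' μ θ)) ≤ kappa μ θ) :
    localRate n (expDist μ θ) (expFamily μ) (dpEstimators ℝ ε) (expParam μ) ≤
      ENNReal.ofReal (C / (2 * √((n : ℝ) * logPartition'' μ θ))) := by
  have := neZero_of_forall_compl_ne_zero hμ
  refine iSup₂_le fun Q hQ => ?_
  obtain ⟨θ', hθ', rfl⟩ := hQ
  have hp := expParam_expDist μ hμ θ (interior_subset hθ)
  have hp' := expParam_expDist μ hμ θ' hθ'
  -- A far alternative is told apart privately, and the estimator outputs `θ` or `θ'` exactly. For a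
  -- near one the constant midpoint has error half the distance, whence the factor `2` in the rate.
  rcases lt_or_ge (C / √((n : ℝ) * logPartition'' μ θ)) |θ - θ'| with hfar | hnear
  · obtain ⟨f, hf, hsep⟩ := exists_private_separating_estimator hμ hζ hC hn hε hθ hkurt hkap hθ'
      hfar θ θ'
    refine (iInf₂_le f hf).trans (max_le (errorRate_le ?_) (errorRate_le ?_))
    · exact (hsep n le_rfl _ (measurableSet_ofReal_abs_sub_le _ _)).1 (by simp [hp])
    · exact (hsep n le_rfl _ (measurableSet_ofReal_abs_sub_le _ _)).2 (by simp [hp'])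
  · have hε0 : 0 ≤ ε := le_trans (by positivity) hε
    have hhalf : |θ - θ'| / 2 ≤ C / (2 * √((n : ℝ) * logPartition'' μ θ)) := by
      rw [mul_comm, ← div_div]
      linarith
    have hconst : ∀ {P : Measure ℝ} [IsProbabilityMeasure P] (y : ℝ) {E : Set ℝ},
        MeasurableSet E → y ∈ E → 3 / 4 ≤ (logisticEstimator (fun _ : ℝ => (0 : ℝ))
          measurable_const 0 ε y y).outputLaw n P E := by
      intro P _ y E hE hy
      have hmk := (logisticEstimator (fun _ : ℝ => (0 : ℝ)) measurable_const 0 ε y y).markov n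
      have : ∀ d : Fin n → ℝ, (logisticEstimator (fun _ : ℝ => (0 : ℝ))
          measurable_const 0 ε y y).kernel n d E = 1 := by
        intro d
        rw [← prob_compl_eq_zero_iff hE, logisticEstimator_kernel_apply,
          Measure.dirac_apply' _ hE.compl]
        simp [hy]
      rw [Mechanism.outputLaw_apply _ _ _ hE]
      simp only [this, lintegral_const, measure_univ, mul_one]
      exact ENNReal.div_le_of_le_mul (by norm_num)
    have hP := isProbabilityMeasure_expDist (interior_subset hθ)
    have hQ := isProbabilityMeasure_expDist hθ'
    have hdp : logisticEstimator (fun _ : ℝ => (0 : ℝ)) measurable_const 0 ε ((θ + θ') / 2)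
        ((θ + θ') / 2) ∈ dpEstimators ℝ ε := isDP_const _ hε0
    refine (iInf₂_le _ hdp).trans
      (max_le (errorRate_le (hconst _ (measurableSet_ofReal_abs_sub_le _ _) ?_))
        (errorRate_le (hconst _ (measurableSet_ofReal_abs_sub_le _ _) ?_)))
    · rw [hp]
      refine ENNReal.ofReal_le_ofReal (le_trans (le_of_eq ?_) hhalf)
      rw [show (θ + θ') / 2 - θ = -((θ - θ') / 2) by ring, abs_neg, abs_div, abs_two]
    · rw [hp']
      refine ENNReal.ofReal_le_ofReal (le_trans (le_of_eq ?_) hhalf)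
      rw [show (θ + θ') / 2 - θ' = (θ - θ') / 2 by ring, abs_div, abs_two]

end ExponentialFamily

end PrivEst

theorem mainTheorem5 :
    ∀ ζ : ℝ, 0 < ζ →
      ∃ k C₁ C₂ C₃ C₄ : ℝ, ∃ N : ℕ, 0 < k ∧ 0 < C₁ ∧ 0 < C₂ ∧ 0 < C₃ ∧ 0 < C₄ ∧ 0 < N ∧
        ∀ (μ : Measure ℝ), (∀ a : ℝ, μ {a}ᶜ ≠ 0) →
        ∀ (ε : ℕ → ℝ) (θ : ℝ), θ ∈ interior (paramSpace μ) →
        ∀ n : ℕ, N ≤ n →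
          k / √(n : ℝ) ≤ ε n →
          (∀ θ' ∈ smoothInterval μ θ, kurtosis μ θ' ≤ ζ) →
          ENNReal.ofReal (C₂ / √((n : ℝ) * logPartition'' μ θ)) ≤ kappa μ θ →
          -- the private modulus of continuity
          (ENNReal.ofReal (C₁ / √((n : ℝ) * logPartition'' μ θ)) ≤
              modulus n (expDist μ θ) (testClass (dpEstimators ℝ (ε n))) (expFamily μ)
                (expParam μ) ∧
            modulus n (expDist μ θ) (testClass (dpEstimators ℝ (ε n))) (expFamily μ)
                (expParam μ) ≤
              ENNReal.ofReal (C₂ / √((n : ℝ) * logPartition'' μ θ))) ∧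
          -- the private modulus is of the order of the non-private modulus
          (ENNReal.ofReal C₃ *
                modulus n (expDist μ θ) (testClass (allEstimators ℝ)) (expFamily μ)
                  (expParam μ) ≤
              modulus n (expDist μ θ) (testClass (dpEstimators ℝ (ε n))) (expFamily μ)
                (expParam μ) ∧
            modulus n (expDist μ θ) (testClass (dpEstimators ℝ (ε n))) (expFamily μ)
                (expParam μ) ≤
              ENNReal.ofReal C₄ *
                modulus n (expDist μ θ) (testClass (allEstimators ℝ)) (expFamily μ)
                  (expParam μ)) ∧
          -- the private local estimation rate
          (ENNReal.ofReal (C₁ / (2 * √((n : ℝ) * logPartition'' μ θ))) ≤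
              localRate n (expDist μ θ) (expFamily μ) (dpEstimators ℝ (ε n)) (expParam μ) ∧
            localRate n (expDist μ θ) (expFamily μ) (dpEstimators ℝ (ε n)) (expParam μ) ≤
              ENNReal.ofReal (C₂ / (2 * √((n : ℝ) * logPartition'' μ θ)))) ∧
          -- the private local estimation rate is of the order of the non-private one
          (ENNReal.ofReal C₃ *
                localRate n (expDist μ θ) (expFamily μ) (allEstimators ℝ) (expParam μ) ≤
              localRate n (expDist μ θ) (expFamily μ) (dpEstimators ℝ (ε n)) (expParam μ) ∧
            localRate n (expDist μ θ) (expFamily μ) (dpEstimators ℝ (ε n)) (expParam μ) ≤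
              ENNReal.ofReal C₄ *
                localRate n (expDist μ θ) (expFamily μ) (allEstimators ℝ) (expParam μ)) := by
  intro ζ hζ
  set C : ℝ := 192 * (2 + 32 * ζ) with hC
  have hC1 : 1 ≤ C := by rw [hC]; linarith
  -- `C₃ = 1` comes from inclusion of the classes, and `C₄ = 4 C` is the ratio of the private upper
  -- constant `C` to the non-private lower constant `1/4`.
  refine ⟨1, 1 / 4, C, 1, 4 * C, ⌈C ^ 2⌉₊ + 1, one_pos, by norm_num, by linarith, one_pos,
    by linarith, Nat.succ_pos _, ?_⟩
  intro μ hμ ε θ hθ n hN hε hkurt hkap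
  have hn0 : 0 < n := by omega
  have hn : C ^ 2 ≤ n := Nat.ceil_le.1 (by omega)
  have hkap1 : ENNReal.ofReal (1 / √((n : ℝ) * logPartition'' μ θ)) ≤ kappa μ θ :=
    (ENNReal.ofReal_le_ofReal (by gcongr)).trans hkap
  have hsub : dpEstimators ℝ (ε n) ⊆ allEstimators ℝ := Set.subset_univ _
  have hm1 := le_modulus_allEstimators hμ hn0 hθ hkap1
  have hm2 := modulus_anti (testClass_mono hsub) n (expDist μ θ) (expFamily μ) (expParam μ)
  have hm3 := modulus_dpEstimators_le hμ hζ hC hn hε hθ hkurt hkap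
  have hl1 := le_localRate_allEstimators hμ hn0 hθ hkap1
  have hl2 := localRate_anti hsub n (expDist μ θ) (expFamily μ) (expParam μ)
  have hl3 := localRate_dpEstimators_le hμ hζ hC hn hε hθ hkurt hkap
  have hC4 : 0 ≤ 4 * C := by linarith
  refine ⟨⟨hm1.trans hm2, hm3⟩, ⟨by simpa using hm2, hm3.trans ?_⟩, ⟨hl1.trans hl2, hl3⟩,
    ⟨by simpa using hl2, hl3.trans ?_⟩⟩
  · refine le_trans (le_of_eq ?_) (mul_le_mul_right hm1 _)
    rw [← ENNReal.ofReal_mul hC4]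
    congr 1
    ring
  · refine le_trans (le_of_eq ?_) (mul_le_mul_right hl1 _)
    rw [← ENNReal.ofReal_mul hC4]
    congr 1
    ring
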